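/- **Theorem (Convergence of smooth subsamples).** Let $d\ge 1$ and let $\mathbb P$ be a probability distribution on $\mathbb R^d$ with compact support $\mathbb X$ and with a bounded Lebesgue density $f$ such that $f>\lambda$ uniformly on $\mathbb X$, i.e. $\inf_{\mathbb X} f>\lambda$, for a constant $\lambda>0$. Assume that $\mathbb X$ has no cusps or thin parts: there are $c,r_0>0$ such that for every $\mathbf x\in\mathbb X$ and $0<r\le r_0$ the set $\mathbb X\cap B(\mathbf x,r)$ contains a ball of radius $cr$. Let $\mathbf x\mapsto K(\|\mathbf x\|)$ be a bounded probability density on $\mathbb R^d$ that is decreasing in $\|\mathbf x\|$, with $\|\mathbf x\|^{d+1}K(\|\mathbf x\|)\to 0$ as $\|\mathbf x\|\to\infty$ and $K(\|\mathbf x\|)\ge r_1\mathbf 1(\mathbf x\in B(0,r_2))$ for some $r_1,r_2>0$. Let $\sigma=\sigma_n>0$ be bandwidths with $\sigma_n\to 0$, let $\mathbf x_1,\mathbf x_2,\dots$ be i.i.d. from $\mathbb P$, and let $$\widehat f_\sigma(\mathbf x)=\frac1n\sum_{i=1}^n\sigma^{-d}K(\|\mathbf x-\mathbf x_i\|/\sigma).$$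 Let $V\supseteq\mathbb X$ be a measurable set of finite volume, let $\Gamma_n\ge\sup_{V}\widehat f_\sigma$ be a measurable function of $\mathbf x_1,\dots,\mathbf x_n$, and let $B_n$ be integers with $n=O(B_n)$ (for instance $B_n=n$). Let $\mathbb X_n^*$ be the set of the $B_n$ points produced by rejection sampling from the KDE thresholded at $\lambda$: each point is obtained by repeating independent draws of $\mathbf x^*$ uniform on $V$ and $u\sim U(0,\Gamma_n)$, independently of each other and, given the data, of everything drawn before for the same $n$, until $u\le\widehat f_\sigma(\mathbf x^*)$ and $\widehat f_\sigma(\mathbf x^*)\ge\lambda$, and returning this $\mathbf x^*$. (Nothing is assumed on the joint law of the draws for different $n$.) Let $\beta_n\ge 0$ satisfy $\beta_n=o\big((n/\log n)^{1/d}\big)$, and suppose that $\beta_n\sigma_n\to 0$, or that $K$ is the Gaussian kernel and $\beta_n^{d+1}\sigma_n\to 0$. Then almost surely all loops of the procedure terminate for all large $n$, and $$\beta_n\, d_H(\mathbb X_n^*,\mathbb X)\to 0,$$ where $d_H$ is the Hausdorff distance for the Euclidean metric. -/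

import Mathlib

open MeasureTheory ProbabilityTheory Filter Topology Asymptotics

namespace SmoothSubsampling

noncomputable section

/-- `K : ℝ → ℝ` is the radial profile of a kernel `x ↦ K ‖x‖` on `ℝᵈ`: a bounded probability
density, decreasing in `‖x‖`, with `‖x‖ ^ (d + 1) * K ‖x‖ → 0` as `‖x‖ → ∞`, and bounded below by
`r₁` on some ball `B(0, r₂)`, with `r₁, r₂ > 0`. Only the values of `K` on `[0, ∞)` matter. -/
structure IsKernelProfile (d : ℕ) (K : ℝ → ℝ) : Prop where
  nonneg : ∀ t, 0 ≤ t → 0 ≤ K t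
  bounded : ∃ C, ∀ t, 0 ≤ t → K t ≤ C
  antitone : AntitoneOn K (Set.Ici 0)
  integrable : Integrable (fun x : EuclideanSpace ℝ (Fin d) => K ‖x‖)
  integral_eq_one : ∫ x : EuclideanSpace ℝ (Fin d), K ‖x‖ = 1
  tail : Tendsto (fun t : ℝ => t ^ (d + 1) * K t) atTop (𝓝 0)
  lower : ∃ r₁ > 0, ∃ r₂ > 0, ∀ x : EuclideanSpace ℝ (Fin d),
    x ∈ Metric.ball 0 r₂ → r₁ ≤ K ‖x‖

/-- The profile of the standard Gaussian density on `ℝᵈ`. -/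
def gaussianProfile (d : ℕ) (t : ℝ) : ℝ :=
  (2 * Real.pi) ^ (-(d : ℝ) / 2) * Real.exp (-t ^ 2 / 2)

/-- The kernel density estimate with bandwidth `σ` fitted to the data `v 0, …, v (n - 1)`. -/
def kde {d : ℕ} (K : ℝ → ℝ) (σ : ℝ) {n : ℕ} (v : Fin n → EuclideanSpace ℝ (Fin d))
    (x : EuclideanSpace ℝ (Fin d)) : ℝ :=
  (1 / (n : ℝ)) * ∑ i, (σ ^ d)⁻¹ * K (‖x - v i‖ / σ)

/-- One turn of the rejection loop with fitted density `g`, envelope constant `Γ` and threshold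
`lam`: the proposal is `p.1`, the uniform draw on `(0, Γ)` is `u = Γ * p.2` with `p.2` uniform on
`(0, 1)`, and the loop stops when `u ≤ g p.1` and `lam ≤ g p.1`. -/
def Accepts {d : ℕ} (g : EuclideanSpace ℝ (Fin d) → ℝ) (Γ lam : ℝ)
    (p : EuclideanSpace ℝ (Fin d) × ℝ) : Prop :=
  Γ * p.2 ≤ g p.1 ∧ lam ≤ g p.1

/-- The repeat-until loop fed with the draws `w 0, w 1, …` stops and returns `x`, the proposal of
the first accepted turn. -/
def LoopReturns {d : ℕ} (g : EuclideanSpace ℝ (Fin d) → ℝ) (Γ lam : ℝ)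
    (w : ℕ → EuclideanSpace ℝ (Fin d) × ℝ) (x : EuclideanSpace ℝ (Fin d)) : Prop :=
  ∃ j, Accepts g Γ lam (w j) ∧ (∀ i < j, ¬ Accepts g Γ lam (w i)) ∧ x = (w j).1

/-- The set of the points returned by `B` runs of the loop, the `k`-th run being fed with the draws
`w (k, 0), w (k, 1), …`. -/
def smoothSubsample {d : ℕ} (g : EuclideanSpace ℝ (Fin d) → ℝ) (Γ lam : ℝ) (B : ℕ)
    (w : ℕ × ℕ → EuclideanSpace ℝ (Fin d) × ℝ) : Set (EuclideanSpace ℝ (Fin d)) :=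
  {x | ∃ k < B, LoopReturns g Γ lam (fun j => w (k, j)) x}

/-- `S` is thick near each of its points, uniformly at all small scales (no cusps or thin parts):
for every `x ∈ S` and every small `r`, the set `S ∩ B(x, r)` contains a ball of radius `c * r`. -/
def IsThick {d : ℕ} (S : Set (EuclideanSpace ℝ (Fin d))) : Prop :=
  ∃ c > 0, ∃ r₀ > 0, ∀ x ∈ S, ∀ r, 0 < r → r ≤ r₀ →
    ∃ y, Metric.ball y (c * r) ⊆ S ∩ Metric.ball x r

end

end SmoothSubsampling

namespace SmoothSubsampling

noncomputable section

local notation "𝔼" d => EuclideanSpace ℝ (Fin d)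

variable {d n : ℕ} {K : ℝ → ℝ} {σ : ℝ}

/-! The proof needs no consistency of the density estimate, only counts of data points in balls at
the scale `s = max (σ n) ((log n / n) ^ (1 / d))`, for which `n * s ^ d ≥ log n` and `β n * s → 0`.
It shows that almost surely, for a fixed large `T` and all large `n`, the two sets are within `(T +
1) * s` of each other.

Returned points are close to the support. The density is bounded, so by Chernoff's bound no ball of
radius `s` holds more than `C * n * s ^ d` data points. At distance more than `T * s` from all data
the estimate is then at most a constant times the kernel mass outside a ball of radius `T / 4`,
which is below `lam` for large `T` (`kde_le_tail`, `exists_dist_le_of_le_kde`).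

Support points are close to returned points. Near each point `j` of an `s`-net, thickness provides a
ball of radius `R = c * T * s` inside the support, where the density is at least `lam' > lam`. This
ball holds nearly its expected share of data, so the estimate has mass close to `lam' * vol` there
or more, of which at most `lam * vol` lies below the threshold
(`mass_le_setIntegral_superlevel_kde`). The remaining mass, of order `s ^ d`, bounds from below the
probability that one run returns a point of the ball, whatever the envelope constant
(`accepts_odds`). Hence all `B n` runs miss the ball with probability at most `n ^ (-3)` when `T` is
large (`rejection_sampling_bounds`).

The net has `O(n)` points, so a union bound and Borel-Cantelli (`ae_eventually_forall_notMem`) make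
all these events hold eventually. -/

/-- The number of the points `v 0, …, v (n - 1)` that lie in `A`, as a real number. -/
def hits {S : Type*} (A : Set S) (v : Fin n → S) : ℝ := ∑ i, A.indicator (fun _ => (1 : ℝ)) (v i)

lemma hits_nonneg {S : Type*} (A : Set S) (v : Fin n → S) : 0 ≤ hits A v :=
  Finset.sum_nonneg fun _ _ => Set.indicator_nonneg (fun _ _ => zero_le_one) _

lemma hits_mono {S : Type*} {A A' : Set S} (h : A ⊆ A') (v : Fin n → S) : hits A v ≤ hits A' v :=
  Finset.sum_le_sum fun _ _ => Set.indicator_le_indicator_of_subset h (fun _ => zero_le_one) _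

lemma measurable_hits {S : Type*} [MeasurableSpace S] {A : Set S} (hA : MeasurableSet A) :
    Measurable (fun v : Fin n → S => hits A v) := by
  unfold hits
  exact Finset.measurable_sum _ fun i _ =>
    (measurable_const.indicator hA).comp (measurable_pi_apply i)

/-! ### Integrals of the kernel density estimate -/

lemma IsKernelProfile.measurable_comp (hK : IsKernelProfile d K) {S : Type*} [MeasurableSpace S]
    {g : S → ℝ} (hg : Measurable g) (hg0 : ∀ s, 0 ≤ g s) : Measurable fun s => K (g s) := by
  -- `K` is monotone on `[0, ∞)` only; truncating its argument at `0` makes it globally antitone,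
  -- hence measurable.
  have h : Antitone fun t => K (max t 0) := fun a b hab =>
    hK.antitone (Set.mem_Ici.2 (le_max_right _ _)) (Set.mem_Ici.2 (le_max_right _ _))
      (max_le_max_right 0 hab)
  simpa [Function.comp_def, max_eq_left (hg0 _)] using h.measurable.comp hg

lemma kde_eq (hσ : 0 < σ) (v : Fin n → 𝔼 d) (x : 𝔼 d) :
    kde K σ v x = (1 / (n : ℝ)) * ∑ i, (σ ^ d)⁻¹ * K ‖σ⁻¹ • (x - v i)‖ := by
  simp only [kde, norm_smul, norm_inv, Real.norm_eq_abs, abs_of_pos hσ]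
  simp only [div_eq_inv_mul]

lemma kde_nonneg (hK : IsKernelProfile d K) (hσ : 0 < σ) (v : Fin n → 𝔼 d) (x : 𝔼 d) :
    0 ≤ kde K σ v x := by
  unfold kde
  exact mul_nonneg (by positivity) (Finset.sum_nonneg fun i _ =>
    mul_nonneg (by positivity) (hK.nonneg _ (by positivity)))

lemma measurable_kde (hK : IsKernelProfile d K) (hσ : 0 < σ) {S : Type*} [MeasurableSpace S]
    {h : S → Fin n → 𝔼 d} {h' : S → 𝔼 d} (hh : Measurable h) (hh' : Measurable h') :
    Measurable fun s => kde K σ (h s) (h' s) := by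
  unfold kde
  refine (Finset.measurable_sum _ fun i _ => ?_).const_mul _
  refine (hK.measurable_comp (g := fun s => ‖h' s - h s i‖ / σ) ?_
    fun q => by positivity).const_mul _
  fun_prop

lemma integral_comp_inv_smul_sub (hσ : 0 < σ) (h : (𝔼 d) → ℝ) (c : 𝔼 d) :
    ∫ x, h (σ⁻¹ • (x - c)) = σ ^ d * ∫ x, h x := by
  rw [integral_sub_right_eq_self (fun x => h (σ⁻¹ • x)) c,
    Measure.integral_comp_inv_smul_of_nonneg volume h hσ.le]
  simp

lemma integrable_comp_inv_smul_sub (hσ : 0 < σ) {h : (𝔼 d) → ℝ} (hh : Integrable h) (c : 𝔼 d) :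
    Integrable fun x => h (σ⁻¹ • (x - c)) :=
  (hh.comp_smul (inv_ne_zero hσ.ne')).comp_sub_right c

lemma integrable_kde (hK : IsKernelProfile d K) (hσ : 0 < σ) (v : Fin n → 𝔼 d) :
    Integrable (kde K σ v) := by
  simp only [funext (kde_eq hσ v)]
  exact (integrable_finsetSum _ fun i _ =>
    (integrable_comp_inv_smul_sub hσ hK.integrable (v i)).const_mul _).const_mul _

lemma integral_kde (hK : IsKernelProfile d K) (hσ : 0 < σ) (hn : 0 < n) (v : Fin n → 𝔼 d) :
    ∫ x, kde K σ v x = 1 := by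
  simp only [kde_eq hσ v]
  rw [integral_const_mul, integral_finsetSum _ fun i _ =>
    (integrable_comp_inv_smul_sub hσ hK.integrable (v i)).const_mul _]
  simp only [integral_const_mul, integral_comp_inv_smul_sub hσ (fun x => K ‖x‖),
    hK.integral_eq_one]
  have : σ ^ d ≠ 0 := by positivity
  have : (n : ℝ) ≠ 0 := by positivity
  simp [*]

/-- The estimate puts at least the empirical mass of `B(y, (1 - η) R)` into `B(y, R)`, up to the
kernel mass outside `B(0, η R / σ)`. -/
lemma hits_mul_le_setIntegral_kde (hK : IsKernelProfile d K) (hσ : 0 < σ)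
    (v : Fin n → 𝔼 d) (y : 𝔼 d) (R η : ℝ) :
    1 / n * (hits (Metric.ball y ((1 - η) * R)) v *
        ∫ u in Metric.ball (0 : 𝔼 d) (η * R / σ), K ‖u‖) ≤
      ∫ x in Metric.ball y R, kde K σ v x := by
  simp only [kde_eq hσ v]
  rw [integral_const_mul, integral_finsetSum _ fun i _ =>
    ((integrable_comp_inv_smul_sub hσ hK.integrable (v i)).const_mul _).integrableOn]
  refine mul_le_mul_of_nonneg_left ?_ (by positivity)
  rw [hits, Finset.sum_mul]
  refine Finset.sum_le_sum fun i _ => ?_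
  rw [integral_const_mul]
  by_cases hi : v i ∈ Metric.ball y ((1 - η) * R)
  -- For a data point in the inner ball, the part of its bump within distance `η * R` stays inside
  -- `B(y, R)`; rescaling by `σ` turns it into the kernel mass of `B(0, η * R / σ)`.
  · rw [Set.indicator_of_mem hi, one_mul, ← div_eq_inv_mul, le_div_iff₀ (by positivity), mul_comm,
      ← integral_indicator Metric.isOpen_ball.measurableSet,
      ← integral_comp_inv_smul_sub hσ _ (v i),
      ← integral_indicator Metric.isOpen_ball.measurableSet]
    refine integral_mono ?_ ?_ fun x => ?_
    · exact integrable_comp_inv_smul_sub hσ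
        (hK.integrable.indicator Metric.isOpen_ball.measurableSet) (v i)
    · exact (integrable_comp_inv_smul_sub hσ hK.integrable (v i)).indicator
        Metric.isOpen_ball.measurableSet
    · simp only
      by_cases hx : σ⁻¹ • (x - v i) ∈ Metric.ball (0 : 𝔼 d) (η * R / σ)
      · rw [Set.indicator_of_mem hx, Set.indicator_of_mem]
        rw [mem_ball_zero_iff, norm_smul, norm_inv, Real.norm_eq_abs, abs_of_pos hσ,
          ← div_eq_inv_mul, div_lt_div_iff_of_pos_right hσ] at hx
        rw [Metric.mem_ball] at hi ⊢
        rw [← dist_eq_norm] at hx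
        linarith [dist_triangle x (v i) y]
      · rw [Set.indicator_of_notMem hx]
        exact Set.indicator_nonneg (fun _ _ => hK.nonneg _ (norm_nonneg _)) _
  · rw [Set.indicator_of_notMem hi, zero_mul]
    exact mul_nonneg (by positivity) (integral_nonneg fun x => hK.nonneg _ (norm_nonneg _))

/-- Where no data point is closer than `T * s` the estimate is controlled by a kernel tail,
if balls of radius `s ≥ σ` hold at most `m` data points. -/
lemma kde_le_tail (hK : IsKernelProfile d K) (hσ : 0 < σ) {s : ℝ} (hs : σ ≤ s)
    {m T : ℝ} (hT : 2 ≤ T) (v : Fin n → 𝔼 d) (hm : ∀ z, hits (Metric.ball z s) v ≤ m)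
    (x : 𝔼 d) (hx : ∀ i, T * s ≤ dist x (v i)) :
    volume.real (Metric.ball (0 : 𝔼 d) s) * kde K σ v x ≤
      1 / n * (m * (2 ^ d * ∫ u in (Metric.ball (0 : 𝔼 d) (T / 4))ᶜ, K ‖u‖)) := by
  have hs0 : 0 < s := hσ.trans_le hs
  have hmeas : MeasurableSet (Metric.ball (0 : 𝔼 d) (T / 4))ᶜ :=
    Metric.isOpen_ball.measurableSet.compl
  set h : (𝔼 d) → ℝ := (Metric.ball (0 : 𝔼 d) (T / 4))ᶜ.indicator fun u => K ‖u‖ with hh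
  have h0 : ∀ u, 0 ≤ h u := fun u =>
    Set.indicator_nonneg (fun _ _ => hK.nonneg _ (norm_nonneg _)) _
  have h_int : Integrable h := hK.integrable.indicator hmeas
  have h2σ : 0 < 2 * σ := by positivity
  -- Doubling the bandwidth absorbs a shift by `s`: if `z` is within `s` of `v i`, then `dist z x ≤
  -- 2 * dist x (v i)`, so `K (‖x - v i‖ / σ) ≤ g z`. Also `dist z x ≥ T * s / 2`, which after
  -- division by `2 * σ ≤ 2 * s` gives the cut-off `T / 4`. The dilation costs the factor `2 ^ d`.
  set g : (𝔼 d) → ℝ := fun z => h ((2 * σ)⁻¹ • (z - x)) with hg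
  have hgint : Integrable g := integrable_comp_inv_smul_sub h2σ h_int x
  have hgI : ∫ z, g z = (2 * σ) ^ d * ∫ u in (Metric.ball (0 : 𝔼 d) (T / 4))ᶜ, K ‖u‖ := by
    rw [hg, integral_comp_inv_smul_sub h2σ h x, hh, integral_indicator hmeas]
  have key : ∀ i, volume.real (Metric.ball (0 : 𝔼 d) s) * K (‖x - v i‖ / σ) ≤
      ∫ z in Metric.ball (v i) s, g z := by
    intro i
    have hvol : volume.real (Metric.ball (v i) s) = volume.real (Metric.ball (0 : 𝔼 d) s) := by
      simp only [measureReal_def, Measure.addHaar_ball_center]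
    rw [← hvol, ← smul_eq_mul, ← setIntegral_const]
    refine setIntegral_mono_on (integrableOn_const Metric.isBounded_ball.measure_lt_top.ne)
      hgint.integrableOn Metric.isOpen_ball.measurableSet fun z hz => ?_
    have hxi := hx i
    rw [Metric.mem_ball] at hz
    have e1 : dist x (v i) ≤ dist z x + dist z (v i) := by
      rw [dist_comm z x]; exact dist_triangle _ _ _
    have e2 : dist z x ≤ dist z (v i) + dist x (v i) := by
      rw [dist_comm x]; exact dist_triangle _ _ _
    have e3 : ‖(2 * σ)⁻¹ • (z - x)‖ = dist z x / (2 * σ) := by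
      rw [norm_smul, norm_inv, Real.norm_eq_abs, abs_of_pos h2σ, dist_eq_norm, div_eq_inv_mul]
    have hmem : (2 * σ)⁻¹ • (z - x) ∈ (Metric.ball (0 : 𝔼 d) (T / 4))ᶜ := by
      rw [Set.mem_compl_iff, mem_ball_zero_iff, not_lt, e3, le_div_iff₀ h2σ]
      nlinarith
    simp only [hg, hh]
    rw [Set.indicator_of_mem hmem, e3]
    refine hK.antitone (Set.mem_Ici.2 (by positivity)) (Set.mem_Ici.2 (by positivity)) ?_
    have e4 : dist z x ≤ 2 * dist x (v i) := by nlinarith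
    rw [div_le_div_iff₀ h2σ hσ, ← dist_eq_norm]
    nlinarith
  -- The balls around the data overlap at `z` exactly `hits (Metric.ball z s) v` times, so `m`
  -- bounds their multiplicity.
  have hsum : ∑ i, ∫ z in Metric.ball (v i) s, g z ≤ m * ∫ z, g z := by
    simp only [← integral_indicator (Metric.isOpen_ball (x := v _) (ε := s)).measurableSet]
    rw [← integral_finsetSum _ fun i _ => hgint.indicator Metric.isOpen_ball.measurableSet,
      ← integral_const_mul]
    refine integral_mono (integrable_finsetSum _ fun i _ =>
      hgint.indicator Metric.isOpen_ball.measurableSet) (hgint.const_mul m) fun z => ?_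
    have : ∑ i, (Metric.ball (v i) s).indicator g z = hits (Metric.ball z s) v * g z := by
      rw [hits, Finset.sum_mul]
      refine Finset.sum_congr rfl fun i _ => ?_
      by_cases hz : z ∈ Metric.ball (v i) s
      · rw [Set.indicator_of_mem hz, Set.indicator_of_mem (Metric.mem_ball_comm.1 hz), one_mul]
      · rw [Set.indicator_of_notMem hz,
          Set.indicator_of_notMem (fun h => hz (Metric.mem_ball_comm.1 h)), zero_mul]
    simp only [this]
    exact mul_le_mul_of_nonneg_right (hm z) (h0 _)
  have hσd : 0 < σ ^ d := by positivity
  calc volume.real (Metric.ball (0 : 𝔼 d) s) * kde K σ v x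
      = 1 / n * ((σ ^ d)⁻¹ *
          ∑ i, volume.real (Metric.ball (0 : 𝔼 d) s) * K (‖x - v i‖ / σ)) := by
        rw [kde, ← Finset.mul_sum, ← Finset.mul_sum]; ring
    _ ≤ 1 / n * ((σ ^ d)⁻¹ * (m * ∫ z, g z)) := by
        gcongr
        exact (Finset.sum_le_sum fun i _ => key i).trans hsum
    _ = _ := by
        rw [hgI, mul_pow]
        field_simp

/-! ### Nets -/

/-- A set whose points carry balls of radius `δ` of mass at least `a` has a `2 δ`-net with at
most `1 / a` elements. -/
lemma exists_finset_net {S : Type*} [PseudoMetricSpace S] [MeasurableSpace S]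
    [OpensMeasurableSpace S] (P : Measure S) [IsProbabilityMeasure P] (A : Set S) {δ a : ℝ}
    (hδ : 0 < δ) (ha : 0 < a) (h : ∀ x ∈ A, a ≤ P.real (Metric.ball x δ)) :
    ∃ N : Finset S, ↑N ⊆ A ∧ (∀ x ∈ A, ∃ y ∈ N, dist x y < 2 * δ) ∧ N.card * a ≤ 1 := by
  classical
  have hcard : ∀ F : Finset S, ↑F ⊆ A → (F : Set S).Pairwise (fun x y => 2 * δ ≤ dist x y) →
      F.card * a ≤ 1 := by
    intro F hF hsep
    calc (F.card : ℝ) * a = ∑ x ∈ F, a := by simp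
      _ ≤ ∑ x ∈ F, P.real (Metric.ball x δ) := Finset.sum_le_sum fun x hx => h x (hF hx)
      _ = P.real (⋃ x ∈ F, Metric.ball x δ) := by
        refine (measureReal_biUnion_finset (fun x hx y hy hxy => ?_) fun x _ =>
          Metric.isOpen_ball.measurableSet).symm
        exact Metric.ball_disjoint_ball (by linarith [hsep hx hy hxy])
      _ ≤ 1 := measureReal_le_one
  by_contra! hcon
  -- A separated set that cannot be enlarged is a net, and `hcard` bounds its size, contrary to
  -- `hcon`. So separated sets of every size would exist, against `hcard` again.
  have hex : ∀ k : ℕ, ∃ F : Finset S, ↑F ⊆ A ∧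
      (F : Set S).Pairwise (fun x y => 2 * δ ≤ dist x y) ∧ F.card = k := by
    intro k
    induction k with
    | zero => exact ⟨∅, by simp⟩
    | succ k ih =>
      obtain ⟨F, hFA, hsep, hk⟩ := ih
      obtain ⟨x, hxA, hx⟩ : ∃ x ∈ A, ∀ y ∈ F, 2 * δ ≤ dist x y := by
        by_contra! hx
        exact absurd (hcard F hFA hsep) (not_le.2 (hcon F hFA hx))
      have hxF : x ∉ F := fun hxF => by
        have := hx x hxF
        rw [dist_self] at this
        linarith
      refine ⟨insert x F, ?_, ?_, ?_⟩
      · rw [Finset.coe_insert]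
        exact Set.insert_subset hxA hFA
      · rw [Finset.coe_insert]
        refine hsep.insert fun y hy _ => ⟨hx y hy, ?_⟩
        rw [dist_comm]
        exact hx y hy
      · rw [Finset.card_insert_of_notMem hxF, hk]
  obtain ⟨k, hk⟩ := exists_nat_gt (1 / a)
  obtain ⟨F, hFA, hsep, hFk⟩ := hex k
  have := hcard F hFA hsep
  rw [hFk, ← le_div_iff₀ ha] at this
  linarith

/-! ### Masses of balls -/

lemma volume_real_ball (y : 𝔼 d) {r : ℝ} (hr : 0 < r) :
    volume.real (Metric.ball y r) = r ^ d * volume.real (Metric.ball (0 : 𝔼 d) 1) := by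
  rw [measureReal_def, Measure.addHaar_ball_of_pos volume y hr, ENNReal.toReal_mul,
    ENNReal.toReal_ofReal (by positivity)]
  simp [measureReal_def]

lemma volume_real_unit_ball_pos : 0 < volume.real (Metric.ball (0 : 𝔼 d) 1) :=
  ENNReal.toReal_pos (Metric.measure_ball_pos volume _ one_pos).ne'
    Metric.isBounded_ball.measure_lt_top.ne

section Density

variable {P : Measure (𝔼 d)} {f : (𝔼 d) → ℝ}

lemma withDensity_real_ball_le
    (hf_density : P = volume.withDensity (fun x => ENNReal.ofReal (f x)))
    {M : ℝ} (hM0 : 0 ≤ M) (hM : ∀ x, f x ≤ M) (y : 𝔼 d) {r : ℝ} (hr : 0 < r) :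
    P.real (Metric.ball y r) ≤ M * (r ^ d * volume.real (Metric.ball (0 : 𝔼 d) 1)) := by
  rw [← volume_real_ball y hr, measureReal_def, measureReal_def]
  refine ENNReal.toReal_le_of_le_ofReal (by positivity) ?_
  rw [ENNReal.ofReal_mul hM0, ENNReal.ofReal_toReal Metric.isBounded_ball.measure_lt_top.ne,
    hf_density, withDensity_apply _ Metric.isOpen_ball.measurableSet]
  calc ∫⁻ x in Metric.ball y r, ENNReal.ofReal (f x)
      ≤ ∫⁻ _ in Metric.ball y r, ENNReal.ofReal M :=
        lintegral_mono fun x => ENNReal.ofReal_le_ofReal (hM x)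
    _ = _ := by simp

lemma le_withDensity_real_ball [IsFiniteMeasure P]
    (hf_density : P = volume.withDensity (fun x => ENNReal.ofReal (f x)))
    {l : ℝ} (hl0 : 0 ≤ l) {y : 𝔼 d} {r : ℝ} (hr : 0 < r) (hl : ∀ x ∈ Metric.ball y r, l ≤ f x) :
    l * (r ^ d * volume.real (Metric.ball (0 : 𝔼 d) 1)) ≤ P.real (Metric.ball y r) := by
  rw [← volume_real_ball y hr, measureReal_def, measureReal_def]
  rw [← ENNReal.ofReal_le_iff_le_toReal (measure_ne_top _ _)]
  rw [ENNReal.ofReal_mul hl0, ENNReal.ofReal_toReal Metric.isBounded_ball.measure_lt_top.ne,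
    hf_density, withDensity_apply _ Metric.isOpen_ball.measurableSet]
  calc _ = ∫⁻ _ in Metric.ball y r, ENNReal.ofReal l := by simp
    _ ≤ ∫⁻ x in Metric.ball y r, ENNReal.ofReal (f x) :=
        setLIntegral_mono' Metric.isOpen_ball.measurableSet
          fun x hx => ENNReal.ofReal_le_ofReal (hl x hx)

end Density

/-! ### Concentration of empirical masses -/

section Chernoff

variable {Ω : Type*} [MeasurableSpace Ω] {μ : Measure Ω} {S : Type*} [MeasurableSpace S]
  {P : Measure S} {X : ℕ → Ω → S}

/-- The count is a sum of independent Bernoulli variables; `1 + x ≤ exp x` dominates its moment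
generating function by that of the Poisson law of the same mean. -/
lemma mgf_hits_le [IsProbabilityMeasure P] (hX_meas : ∀ i, Measurable (X i))
    (hX_indep : iIndepFun X μ) (hX_law : ∀ i, μ.map (X i) = P) {A : Set S} (hA : MeasurableSet A)
    (n : ℕ) (t : ℝ) :
    mgf (fun ω => hits A fun i : Fin n => X i ω) μ t ≤
      Real.exp (n * P.real A * (Real.exp t - 1)) := by
  set φ : S → ℝ := A.indicator fun _ => (1 : ℝ) with hφ
  have hφm : Measurable φ := measurable_const.indicator hA
  have hind : iIndepFun (fun (i : Fin n) ω => φ (X i ω)) μ :=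
    (hX_indep.precomp Fin.val_injective).comp (fun _ => φ) fun _ => hφm
  have hsum : (fun ω => hits A fun i : Fin n => X i ω) =
      ∑ i : Fin n, fun ω => φ (X i ω) := by
    funext ω
    simp [hits, hφ]
  have hone : ∀ i, mgf (fun ω => φ (X i ω)) μ t = 1 + P.real A * (Real.exp t - 1) := by
    intro i
    have h1 : ∀ x, Real.exp (t * φ x) = 1 + A.indicator (fun _ => Real.exp t - 1) x := by
      intro x
      by_cases hx : x ∈ A <;> simp [hφ, hx]
    have h2 : mgf (fun ω => φ (X i ω)) μ t = ∫ x, Real.exp (t * φ x) ∂P := by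
      rw [← hX_law i, integral_map (hX_meas i).aemeasurable]
      · rfl
      · exact (hφm.const_mul t).exp.aestronglyMeasurable
    rw [h2]
    simp only [h1]
    rw [integral_add (integrable_const _) ((integrable_const _).indicator hA),
      integral_indicator_const _ hA]
    simp
  rw [hsum, hind.mgf_sum (fun i => hφm.comp (hX_meas i))]
  simp only [hone, Finset.prod_const, Finset.card_univ, Fintype.card_fin]
  rw [mul_assoc, Real.exp_nat_mul]
  refine pow_le_pow_left₀ ?_ ?_ n
  · nlinarith [Real.exp_pos t, measureReal_nonneg (μ := P) (s := A),
      measureReal_le_one (μ := P) (s := A)]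
  · linarith [Real.add_one_le_exp (P.real A * (Real.exp t - 1))]

lemma integrable_exp_mul_hits [IsFiniteMeasure μ] (hX_meas : ∀ i, Measurable (X i)) {A : Set S}
    (hA : MeasurableSet A) (n : ℕ) (t : ℝ) :
    Integrable (fun ω => Real.exp (t * hits A fun i : Fin n => X i ω)) μ := by
  have hm : Measurable fun ω => hits A fun i : Fin n => X i ω :=
    (measurable_hits hA).comp (measurable_pi_iff.2 fun i => hX_meas i)
  refine Integrable.of_bound (hm.const_mul t).exp.aestronglyMeasurable (Real.exp (|t| * n))
    (ae_of_all _ fun ω => ?_)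
  rw [Real.norm_eq_abs, Real.abs_exp, Real.exp_le_exp]
  have h0 := hits_nonneg A fun i : Fin n => X i ω
  have h1 : hits A (fun i : Fin n => X i ω) ≤ n := by
    calc hits A (fun i : Fin n => X i ω) ≤ ∑ _i : Fin n, (1 : ℝ) :=
          Finset.sum_le_sum fun i _ => Set.indicator_le_self' (fun _ _ => zero_le_one) _
      _ = n := by simp
  exact mul_le_mul (le_abs_self t) h1 h0 (abs_nonneg t)

/-- Upper Chernoff bound for the number of hits. -/
lemma measureReal_le_hits_le [IsFiniteMeasure μ] [IsProbabilityMeasure P]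
    (hX_meas : ∀ i, Measurable (X i))
    (hX_indep : iIndepFun X μ) (hX_law : ∀ i, μ.map (X i) = P) {A : Set S} (hA : MeasurableSet A)
    (n : ℕ) (a : ℝ) :
    μ.real {ω | a ≤ hits A fun i : Fin n => X i ω} ≤ Real.exp (-a + 2 * (n * P.real A)) := by
  -- Parameter `t = 1`, with `e - 1 ≤ 2`.
  refine (measure_ge_le_exp_mul_mgf a zero_le_one
    (integrable_exp_mul_hits hX_meas hA n 1)).trans ?_
  refine (mul_le_mul_of_nonneg_left (mgf_hits_le hX_meas hX_indep hX_law hA n 1)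
    (Real.exp_pos _).le).trans ?_
  rw [← Real.exp_add, Real.exp_le_exp]
  have h : 0 ≤ (n : ℝ) * P.real A := by positivity
  nlinarith [Real.exp_one_lt_d9]

/-- From `exp s ≥ 1 + s + s ^ 2 / 2` and `(1 - s + s ^ 2 / 2) * (1 + s + s ^ 2 / 2) = 1 + s ^ 4 / 4
≥ 1`. -/
lemma exp_neg_le_quadratic {s : ℝ} (hs : 0 ≤ s) : Real.exp (-s) ≤ 1 - s + s ^ 2 / 2 := by
  rw [Real.exp_neg, inv_le_comm₀ (Real.exp_pos _) (by nlinarith [sq_nonneg (s - 1)])]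
  refine le_trans ?_ (Real.quadratic_le_exp_of_nonneg hs)
  rw [inv_le_iff_one_le_mul₀' (by nlinarith [sq_nonneg (s - 1)])]
  nlinarith [sq_nonneg (s ^ 2)]

/-- Lower Chernoff bound for the number of hits. -/
lemma measureReal_hits_le_le [IsFiniteMeasure μ] [IsProbabilityMeasure P]
    (hX_meas : ∀ i, Measurable (X i))
    (hX_indep : iIndepFun X μ) (hX_law : ∀ i, μ.map (X i) = P) {A : Set S} (hA : MeasurableSet A)
    (n : ℕ) {η : ℝ} (hη : 0 ≤ η) :
    μ.real {ω | hits A (fun i : Fin n => X i ω) ≤ (1 - η) * (n * P.real A)} ≤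
      Real.exp (-(η ^ 2 / 2 * (n * P.real A))) := by
  -- With parameter `-η` the exponent is the mean times `η * (1 - η) + exp (-η) - 1`, at most `-η ^
  -- 2 / 2`.
  refine (measure_le_le_exp_mul_mgf _ (neg_nonpos.2 hη)
    (integrable_exp_mul_hits hX_meas hA n (-η))).trans ?_
  refine (mul_le_mul_of_nonneg_left (mgf_hits_le hX_meas hX_indep hX_law hA n (-η))
    (Real.exp_pos _).le).trans ?_
  rw [← Real.exp_add, Real.exp_le_exp]
  have h : 0 ≤ (n : ℝ) * P.real A := by positivity
  nlinarith [exp_neg_le_quadratic hη]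

end Chernoff

/-! ### Almost sure eventual bounds -/

section BorelCantelli

variable {Ω : Type*} [MeasurableSpace Ω] {μ : Measure Ω} [IsFiniteMeasure μ]

/-- A union bound over linearly many events of probability at most `n ^ (-3)`, followed by the
Borel-Cantelli lemma. -/
lemma ae_eventually_forall_notMem {ι : Type*} (N : ℕ → Finset ι) (E : ℕ → ι → Set Ω) (C : ℝ)
    (hN : ∀ᶠ n : ℕ in atTop, ((N n).card : ℝ) ≤ C * n)
    (hE : ∀ᶠ n : ℕ in atTop, ∀ j ∈ N n, μ.real (E n j) ≤ Real.exp (-(3 * Real.log n))) :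
    ∀ᵐ ω ∂μ, ∀ᶠ n in atTop, ∀ j ∈ N n, ω ∉ E n j := by
  obtain ⟨m, hm⟩ := eventually_atTop.1 (hN.and (hE.and (eventually_ge_atTop 1)))
  have hbound : ∀ n ≥ m, μ (⋃ j ∈ N n, E n j) ≤ ENNReal.ofReal (C * (1 / (n : ℝ) ^ 2)) := by
    intro n hn
    obtain ⟨h1, h2, h3⟩ := hm n hn
    have hn0 : (0 : ℝ) < n := by exact_mod_cast h3
    refine (ENNReal.le_ofReal_iff_toReal_le (measure_ne_top _ _) ?_).2 ?_
    · have : 0 ≤ C * n := le_trans (by positivity) h1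
      have : 0 ≤ C := nonneg_of_mul_nonneg_left this hn0
      positivity
    calc μ.real (⋃ j ∈ N n, E n j) ≤ ∑ j ∈ N n, μ.real (E n j) := measureReal_biUnion_finset_le _ _
      _ ≤ ∑ j ∈ N n, Real.exp (-(3 * Real.log n)) := Finset.sum_le_sum h2
      _ = (N n).card * (1 / (n : ℝ) ^ 3) := by
        rw [Finset.sum_const, nsmul_eq_mul, Real.exp_neg, show (3 : ℝ) = (3 : ℕ) by norm_num,
          Real.exp_nat_mul, Real.exp_log hn0, one_div]
      _ ≤ C * n * (1 / (n : ℝ) ^ 3) := by gcongr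
      _ = C * (1 / (n : ℝ) ^ 2) := by field_simp
  -- The bounds hold from `m` on only; earlier events are replaced by `∅` to get a convergent
  -- series.
  have hfin : ∑' n, μ (if m ≤ n then ⋃ j ∈ N n, E n j else ∅) ≠ ⊤ := by
    refine ne_top_of_le_ne_top (Summable.tsum_ofReal_ne_top
      ((Real.summable_one_div_nat_pow.2 one_lt_two).mul_left C)) (ENNReal.tsum_le_tsum fun n => ?_)
    split_ifs with h
    · exact hbound n h
    · simp
  filter_upwards [ae_eventually_notMem hfin] with ω hω
  filter_upwards [hω, eventually_ge_atTop m] with n hn hmn j hj hmem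
  rw [if_pos hmn] at hn
  exact hn (Set.mem_biUnion hj hmem)

end BorelCantelli

/-! ### Repeating independent trials -/

section Loop

variable {Ω : Type*} [MeasurableSpace Ω] {μ : Measure Ω} {S T : Type*} [MeasurableSpace S]
  [MeasurableSpace T]

/-- This makes separate runs independent: the array has an infinite product law, and currying
carries it to the product of the laws of the rows. -/
lemma iIndepFun_curry [IsProbabilityMeasure μ] {ι κ : Type*} {Y : ι × κ → Ω → S}
    (hY : ∀ p, Measurable (Y p)) (h : iIndepFun Y μ) :
    iIndepFun (fun i ω j => Y (i, j) ω) μ := by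
  have h' : iIndepFun (fun (p : (_ : ι) × κ) ω => Y (p.1, p.2) ω) μ :=
    h.precomp (Equiv.sigmaEquivProd ι κ).injective
  have hprob : ∀ i j, IsProbabilityMeasure (μ.map (Y (i, j))) :=
    fun i j => Measure.isProbabilityMeasure_map (hY _).aemeasurable
  have hcomp : (MeasurableEquiv.piCurry (fun (_ : ι) (_ : κ) => S)) ∘
      (fun ω (p : (_ : ι) × κ) => Y (p.1, p.2) ω) = fun ω i j => Y (i, j) ω := by
    ext; simp [Sigma.curry]
  have hrow : ∀ i, μ.map (fun ω j => Y (i, j) ω) =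
      Measure.infinitePi fun j => μ.map (Y (i, j)) := fun i =>
    (h.precomp (Prod.mk_right_injective i)).map_fun_eq_infinitePi_map fun j => hY (i, j)
  rw [iIndepFun_iff_map_fun_eq_infinitePi_map (fun i => measurable_pi_iff.2 fun j => hY (i, j)),
    ← hcomp, ← Measure.map_map (by fun_prop) (by fun_prop),
    h'.map_fun_eq_infinitePi_map (by fun_prop)]
  refine (Measure.infinitePi_map_piCurry (fun i j => μ.map (Y (i, j)))).trans ?_
  simp only [hrow]

/-- Independent trials of positive success probability succeed eventually. -/
lemma measure_forall_notMem_eq_zero {Y : ℕ → Ω → S} (hY : ∀ j, Measurable (Y j))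
    (h : iIndepFun Y μ) {ν : Measure S} [IsProbabilityMeasure ν] (hlaw : ∀ j, μ.map (Y j) = ν)
    {D : Set S} (hD : MeasurableSet D) (hpos : ν D ≠ 0) :
    μ {ω | ∀ j, Y j ω ∉ D} = 0 := by
  have hle : ∀ J : ℕ, μ {ω | ∀ j, Y j ω ∉ D} ≤ (ν Dᶜ) ^ J := by
    intro J
    calc μ {ω | ∀ j, Y j ω ∉ D} ≤ μ (⋂ j ∈ Finset.range J, Y j ⁻¹' Dᶜ) :=
          measure_mono fun ω hω => by
            simp only [Set.mem_iInter]
            exact fun j _ => hω j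
      _ = (ν Dᶜ) ^ J := by
          rw [h.measure_inter_preimage_eq_mul (Finset.range J) fun _ _ => hD.compl]
          rw [Finset.prod_congr rfl (g := fun _ => ν Dᶜ) fun j _ => by
            rw [← hlaw j, Measure.map_apply (hY j) hD.compl]]
          simp
  have hlt : ν Dᶜ < 1 := by
    rw [prob_compl_eq_one_sub hD]
    exact ENNReal.sub_lt_self ENNReal.one_ne_top one_ne_zero hpos
  exact le_antisymm (ge_of_tendsto' (ENNReal.tendsto_pow_atTop_nhds_zero_of_lt_one hlt) hle)
    zero_le

/-- The first success of independent trials falls into `A` with probability at least `q`, if a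
single success does. -/
lemma le_measureReal_first_mem {Y : ℕ → Ω → S} (hY : ∀ j, Measurable (Y j))
    (h : iIndepFun Y μ) {ν : Measure S} [IsProbabilityMeasure ν] (hlaw : ∀ j, μ.map (Y j) = ν)
    {D A : Set S} (hD : MeasurableSet D) (hA : MeasurableSet A) (hpos : 0 < ν.real D)
    {q : ℝ} (hq : q * ν.real D ≤ ν.real (D ∩ A)) :
    q ≤ μ.real {ω | ∃ j, Y j ω ∈ D ∧ (∀ i < j, Y i ω ∉ D) ∧ Y j ω ∈ A} := by
  have hprob : IsProbabilityMeasure μ := h.isProbabilityMeasure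
  set E : ℕ → Set Ω := fun j => {ω | Y j ω ∈ D ∧ (∀ i < j, Y i ω ∉ D) ∧ Y j ω ∈ A} with hE
  have hEm : ∀ j, MeasurableSet (E j) := by
    intro j
    have : E j = (Y j ⁻¹' D ∩ ⋂ i ∈ Finset.range j, Y i ⁻¹' Dᶜ) ∩ Y j ⁻¹' A := by
      ext ω
      simp [hE, and_assoc]
    rw [this]
    exact ((hY j hD).inter (Finset.measurableSet_biInter _ fun i _ => hY i hD.compl)).inter
      (hY j hA)
  -- Stopping at turn `j` in `A` prescribes one set for each of the turns `0, …, j`, so independence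
  -- gives a geometric sequence; its sum is `ν.real (D ∩ A) / ν.real D ≥ q`.
  have hEμ : ∀ j, μ.real (E j) = (1 - ν.real D) ^ j * ν.real (D ∩ A) := by
    intro j
    set B : ℕ → Set S := fun i => if i < j then Dᶜ else D ∩ A with hB
    have hBm : ∀ i, MeasurableSet (B i) := fun i => by
      simp only [hB]
      split_ifs
      exacts [hD.compl, hD.inter hA]
    have hEeq : E j = ⋂ i ∈ Finset.range (j + 1), Y i ⁻¹' B i := by
      ext ω
      simp only [hE, Set.mem_ofPred_eq, Set.mem_iInter, Finset.mem_range, Set.mem_preimage]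
      constructor
      · rintro ⟨h1, h2, h3⟩ i hi
        rcases (Nat.lt_succ_iff.1 hi).lt_or_eq with hij | rfl
        · simpa [hB, hij] using h2 i hij
        · simpa [hB] using ⟨h1, h3⟩
      · intro hω
        have hj := hω j (Nat.lt_succ_self j)
        simp only [hB, lt_irrefl, if_false] at hj
        refine ⟨hj.1, fun i hi => ?_, hj.2⟩
        simpa [hB, hi] using hω i (by omega)
    have hval : ∀ i, μ (Y i ⁻¹' B i) = ν (B i) := fun i => by
      rw [← hlaw i, Measure.map_apply (hY i) (hBm i)]
    rw [hEeq, measureReal_def, h.measure_inter_preimage_eq_mul _ fun i _ => hBm i,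
      ENNReal.toReal_prod, Finset.prod_range_succ]
    simp only [hval]
    congr 1
    · rw [Finset.prod_congr rfl (g := fun _ => 1 - ν.real D)]
      · simp
      · intro i hi
        simp only [hB, if_pos (Finset.mem_range.1 hi)]
        exact probReal_compl_eq_one_sub hD
    · simp [hB, measureReal_def]
  have hdisj : Pairwise (Function.onFun Disjoint E) := by
    intro i j hij
    refine Set.disjoint_left.2 fun ω hi hj => ?_
    rcases lt_or_gt_of_ne hij with hlt | hlt
    · exact hj.2.1 i hlt hi.1
    · exact hi.2.1 j hlt hj.1
  have hpartial : ∀ J : ℕ, q * (1 - (1 - ν.real D) ^ J) ≤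
      μ.real {ω | ∃ j, Y j ω ∈ D ∧ (∀ i < j, Y i ω ∉ D) ∧ Y j ω ∈ A} := by
    intro J
    have hgeom : ν.real D * ∑ j ∈ Finset.range J, (1 - ν.real D) ^ j =
        1 - (1 - ν.real D) ^ J := by
      have := mul_neg_geom_sum (1 - ν.real D) J
      simpa using this
    calc q * (1 - (1 - ν.real D) ^ J)
        = q * ν.real D * ∑ j ∈ Finset.range J, (1 - ν.real D) ^ j := by rw [mul_assoc, hgeom]
      _ ≤ ν.real (D ∩ A) * ∑ j ∈ Finset.range J, (1 - ν.real D) ^ j :=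
          mul_le_mul_of_nonneg_right hq (Finset.sum_nonneg fun j _ =>
            pow_nonneg (sub_nonneg.2 measureReal_le_one) j)
      _ = μ.real (⋃ j ∈ Finset.range J, E j) := by
          rw [measureReal_biUnion_finset (fun i _ j _ hij => hdisj hij) fun j _ => hEm j,
            Finset.mul_sum]
          exact Finset.sum_congr rfl fun j _ => by rw [hEμ, mul_comm]
      _ ≤ _ := by
          refine measureReal_mono fun ω hω => ?_
          simp only [Set.mem_iUnion] at hω
          obtain ⟨j, _, hj⟩ := hω
          exact ⟨j, hj⟩
  have hlim : Tendsto (fun J : ℕ => q * (1 - (1 - ν.real D) ^ J)) atTop (𝓝 (q * (1 - 0))) :=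
    ((tendsto_pow_atTop_nhds_zero_of_lt_one (sub_nonneg.2 measureReal_le_one)
      (by linarith)).const_sub 1).const_mul q
  simpa using le_of_tendsto' hlim hpartial

/-- Bound on the probability that none of `B` independent loops stops in `A`. -/
lemma measureReal_forall_not_first_mem_le [IsProbabilityMeasure μ] {Y : ℕ × ℕ → Ω → S}
    (hY : ∀ p, Measurable (Y p))
    (h : iIndepFun Y μ) {ν : Measure S} [IsProbabilityMeasure ν] (hlaw : ∀ p, μ.map (Y p) = ν)
    {D A : Set S} (hD : MeasurableSet D) (hA : MeasurableSet A) (hpos : 0 < ν.real D)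
    {q : ℝ} (hq : q * ν.real D ≤ ν.real (D ∩ A)) (B : ℕ) :
    μ.real {ω | ∀ k < B, ¬ ∃ j, Y (k, j) ω ∈ D ∧ (∀ i < j, Y (k, i) ω ∉ D) ∧ Y (k, j) ω ∈ A} ≤
      Real.exp (-(q * B)) := by
  set R : Set (ℕ → S) := {w | ∃ j, w j ∈ D ∧ (∀ i < j, w i ∉ D) ∧ w j ∈ A} with hR
  have hRm : MeasurableSet R := by
    have : R = ⋃ j, ((fun w : ℕ → S => w j) ⁻¹' D ∩
        ⋂ i ∈ Finset.range j, (fun w : ℕ → S => w i) ⁻¹' Dᶜ) ∩ (fun w : ℕ → S => w j) ⁻¹' A := by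
      ext w
      simp [hR, and_assoc]
    rw [this]
    exact .iUnion fun j => ((measurable_pi_apply j hD).inter
      (Finset.measurableSet_biInter _ fun i _ => measurable_pi_apply i hD.compl)).inter
      (measurable_pi_apply j hA)
  have hind := iIndepFun_curry hY h
  have hm : ∀ k, Measurable fun ω j => Y (k, j) ω := fun k =>
    measurable_pi_iff.2 fun j => hY (k, j)
  have heq : {ω | ∀ k < B, ¬ ∃ j, Y (k, j) ω ∈ D ∧ (∀ i < j, Y (k, i) ω ∉ D) ∧ Y (k, j) ω ∈ A} =
      ⋂ k ∈ Finset.range B, (fun ω j => Y (k, j) ω) ⁻¹' Rᶜ := by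
    ext ω
    simp only [Set.mem_iInter, Finset.mem_range]
    rfl
  rw [heq, measureReal_def, hind.measure_inter_preimage_eq_mul _ fun _ _ => hRm.compl,
    ENNReal.toReal_prod]
  calc ∏ k ∈ Finset.range B, (μ ((fun ω j => Y (k, j) ω) ⁻¹' Rᶜ)).toReal
      ≤ ∏ k ∈ Finset.range B, Real.exp (-q) := by
        refine Finset.prod_le_prod (fun _ _ => ENNReal.toReal_nonneg) fun k _ => ?_
        have h1 : q ≤ μ.real ((fun ω j => Y (k, j) ω) ⁻¹' R) :=
          le_measureReal_first_mem (fun j => hY (k, j))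
            (h.precomp (Prod.mk_right_injective k)) (fun j => hlaw (k, j)) hD hA hpos hq
        have h2 : μ.real ((fun ω j => Y (k, j) ω) ⁻¹' Rᶜ) =
            1 - μ.real ((fun ω j => Y (k, j) ω) ⁻¹' R) :=
          probReal_compl_eq_one_sub (hm k hRm)
        rw [← measureReal_def, h2]
        linarith [Real.add_one_le_exp (-q)]
    _ = Real.exp (-(q * B)) := by
        rw [Finset.prod_const, Finset.card_range, ← Real.exp_nat_mul]
        ring_nf

/-- Freezing one of two independent variables. -/
lemma measure_pair_mem_le [IsProbabilityMeasure μ] {X : Ω → S} {Y : Ω → T} (hX : Measurable X)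
    (hY : Measurable Y) (h : IndepFun X Y μ) {E : Set (S × T)} (hE : MeasurableSet E)
    {ε : ENNReal} (hε : ∀ s, μ {ω | (s, Y ω) ∈ E} ≤ ε) :
    μ {ω | (X ω, Y ω) ∈ E} ≤ ε := by
  have hpX : IsProbabilityMeasure (μ.map X) := Measure.isProbabilityMeasure_map hX.aemeasurable
  have h1 : μ {ω | (X ω, Y ω) ∈ E} = (μ.map fun ω => (X ω, Y ω)) E :=
    (Measure.map_apply (hX.prodMk hY) hE).symm
  rw [h1, (indepFun_iff_map_prod_eq_prod_map_map hX.aemeasurable hY.aemeasurable).1 h,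
    Measure.prod_apply hE]
  calc ∫⁻ s, (μ.map Y) (Prod.mk s ⁻¹' E) ∂μ.map X ≤ ∫⁻ _, ε ∂μ.map X := by
        refine lintegral_mono fun s => ?_
        rw [Measure.map_apply hY (measurable_prodMk_left hE)]
        exact hε s
    _ = ε := by simp

end Loop

/-! ### The rejection step -/

section Rejection

variable {V : Set (𝔼 d)} {g : (𝔼 d) → ℝ} {Γ lam : ℝ}

lemma measurableSet_accepts (hg : Measurable g) :
    MeasurableSet {p : (𝔼 d) × ℝ | Accepts g Γ lam p} :=
  (measurableSet_le (measurable_snd.const_mul Γ) (hg.comp measurable_fst)).inter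
    (measurableSet_le measurable_const (hg.comp measurable_fst))

lemma volume_Ioo_inter_mul_le {a : ℝ} (hΓ : 0 < Γ) (ha : a ≤ Γ) :
    volume ({t : ℝ | Γ * t ≤ a} ∩ Set.Ioo 0 1) = ENNReal.ofReal (a / Γ) := by
  have ha1 : a / Γ ≤ 1 := (div_le_one hΓ).2 ha
  refine le_antisymm ?_ ?_
  · calc _ ≤ volume (Set.Ioc 0 (a / Γ)) := measure_mono fun t ht =>
          ⟨ht.2.1, (le_div_iff₀' hΓ).2 ht.1⟩
      _ = _ := by simp
  · calc _ = volume (Set.Ioo 0 (a / Γ)) := by simp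
      _ ≤ volume ({t : ℝ | Γ * t ≤ a} ∩ Set.Ioo 0 1) := measure_mono fun t ht =>
        ⟨(le_div_iff₀' hΓ).1 ht.2.le, ht.1, ht.2.trans_le ha1⟩

/-- The probability that a turn of the loop accepts a proposal in `A`. -/
lemma measureReal_accepts_inter (hV : MeasurableSet V)
    (hg : Measurable g) (hg0 : ∀ x, 0 ≤ g x) (h_int : Integrable g) (hΓ : 0 < Γ)
    (hgΓ : ∀ x ∈ V, g x ≤ Γ) {A : Set (𝔼 d)} (hA : MeasurableSet A) :
    ((ProbabilityTheory.cond volume V).prod (volume.restrict (Set.Ioo (0 : ℝ) 1))).real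
        ({p | Accepts g Γ lam p} ∩ Prod.fst ⁻¹' A) =
      (volume.real V * Γ)⁻¹ * ∫ x in V ∩ (A ∩ {x | lam ≤ g x}), g x := by
  have hL : MeasurableSet {x | lam ≤ g x} := measurableSet_le measurable_const hg
  have hAL := hA.inter hL
  have hm := (measurableSet_accepts (Γ := Γ) (lam := lam) hg).inter (measurable_fst hA)
  -- Given a proposal `x ∈ V` above the threshold, the uniform variable accepts with probability `g
  -- x / Γ`; below the threshold the section is empty.
  have hsec : ∀ x ∈ V, (volume.restrict (Set.Ioo (0 : ℝ) 1))
      (Prod.mk x ⁻¹' ({p | Accepts g Γ lam p} ∩ Prod.fst ⁻¹' A)) =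
      (A ∩ {x | lam ≤ g x}).indicator (fun x => ENNReal.ofReal (g x / Γ)) x := by
    intro x hx
    rw [Measure.restrict_apply (measurable_prodMk_left hm)]
    by_cases hxA : x ∈ A ∩ {x | lam ≤ g x}
    · rw [Set.indicator_of_mem hxA, ← volume_Ioo_inter_mul_le hΓ (hgΓ x hx)]
      congr 1
      ext t
      have := hxA.1
      have := hxA.2
      simp_all [Accepts]
    · rw [Set.indicator_of_notMem hxA]
      convert measure_empty (μ := volume)
      ext t
      simp only [Accepts, Set.mem_inter_iff, Set.mem_preimage, Set.mem_ofPred_eq,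
        Set.mem_empty_iff_false, iff_false]
      exact fun h => hxA ⟨h.1.2, h.1.1.2⟩
  rw [measureReal_def, Measure.prod_apply hm, ProbabilityTheory.cond, lintegral_smul_measure,
    setLIntegral_congr_fun hV hsec, setLIntegral_indicator hAL, Set.inter_comm _ V,
    ← ofReal_integral_eq_lintegral_ofReal (h_int.div_const Γ).integrableOn
      (ae_of_all _ fun x => div_nonneg (hg0 x) hΓ.le), integral_div, smul_eq_mul,
    ENNReal.toReal_mul, ENNReal.toReal_ofReal (div_nonneg (integral_nonneg hg0) hΓ.le),
    ENNReal.toReal_inv, measureReal_def, mul_inv, div_eq_mul_inv]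
  ring

/-- The factor `(volume.real V * Γ)⁻¹` is common to both acceptance probabilities and cancels; the
total mass above the threshold is at most `∫ g ≤ 1`, so conditioning on acceptance can only increase
the mass of `A`. -/
lemma accepts_odds (hV : MeasurableSet V) (hV_fin : volume V ≠ ⊤)
    (hg : Measurable g) (hg0 : ∀ x, 0 ≤ g x) (h_int : Integrable g) (hg1 : ∫ x, g x ≤ 1)
    (hlam : 0 < lam) (hgΓ : ∀ x ∈ V, g x ≤ Γ) {A : Set (𝔼 d)} (hA : MeasurableSet A) (hAV : A ⊆ V)
    {q : ℝ} (hq0 : 0 < q) (hq : q ≤ ∫ x in A ∩ {x | lam ≤ g x}, g x) :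
    let ν := (ProbabilityTheory.cond volume V).prod (volume.restrict (Set.Ioo (0 : ℝ) 1))
    0 < ν.real {p | Accepts g Γ lam p} ∧
      q * ν.real {p | Accepts g Γ lam p} ≤
        ν.real ({p | Accepts g Γ lam p} ∩ Prod.fst ⁻¹' A) := by
  intro ν
  have hpos := hq0.trans_le hq
  have hvol : volume (A ∩ {x | lam ≤ g x}) ≠ 0 := by
    intro h0
    rw [setIntegral_measure_zero _ h0] at hpos
    exact lt_irrefl _ hpos
  -- Since `q > 0`, some point of `A` is above the threshold, which forces `Γ > 0`.
  obtain ⟨x, hxA, hxL⟩ := nonempty_of_measure_ne_zero hvol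
  have hΓ : 0 < Γ := hlam.trans_le (le_trans hxL (hgΓ x (hAV hxA)))
  have hV0 : 0 < volume.real V := by
    refine ENNReal.toReal_pos (fun h0 => hvol ?_) hV_fin
    exact measure_mono_null (Set.inter_subset_left.trans hAV) h0
  have hVA : V ∩ (A ∩ {x | lam ≤ g x}) = A ∩ {x | lam ≤ g x} :=
    Set.inter_eq_right.2 (Set.inter_subset_left.trans hAV)
  have h1 : ν.real ({p | Accepts g Γ lam p} ∩ Prod.fst ⁻¹' A) =
      (volume.real V * Γ)⁻¹ * ∫ x in A ∩ {x | lam ≤ g x}, g x := by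
    rw [measureReal_accepts_inter hV hg hg0 h_int hΓ hgΓ hA, hVA]
  have h2 : ν.real {p | Accepts g Γ lam p} ≤ (volume.real V * Γ)⁻¹ := by
    have := measureReal_accepts_inter (lam := lam) hV hg hg0 h_int hΓ hgΓ MeasurableSet.univ
    rw [Set.preimage_univ, Set.inter_univ] at this
    rw [this]
    refine mul_le_of_le_one_right (by positivity) (le_trans ?_ hg1)
    exact setIntegral_le_integral h_int (ae_of_all _ hg0)
  have h3 : 0 < ν.real ({p | Accepts g Γ lam p} ∩ Prod.fst ⁻¹' A) := by
    rw [h1]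
    positivity
  have hνp : IsFiniteMeasure ν := by
    have : IsFiniteMeasure (ProbabilityTheory.cond volume V) := inferInstance
    infer_instance
  refine ⟨h3.trans_le (measureReal_mono Set.inter_subset_left), ?_⟩
  rw [h1, mul_comm]
  exact mul_le_mul h2 hq hq0.le (by positivity)

lemma exists_loopReturns {w : ℕ → (𝔼 d) × ℝ} (h : ∃ j, Accepts g Γ lam (w j)) :
    ∃ x, LoopReturns g Γ lam w x := by
  classical
  exact ⟨_, Nat.find h, Nat.find_spec h, fun i hi => Nat.find_min h hi, rfl⟩

end Rejection

section Subsample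

variable {Ω : Type*} [MeasurableSpace Ω] {μ : Measure Ω} [IsProbabilityMeasure μ]
  {V : Set (𝔼 d)} {lam : ℝ} {Γ : (Fin n → 𝔼 d) → ℝ} {D : Ω → Fin n → 𝔼 d}
  {W : ℕ × ℕ → Ω → (𝔼 d) × ℝ}

lemma measurableSet_accepts_kde (hK : IsKernelProfile d K) (hσ : 0 < σ) (hΓ : Measurable Γ)
    (p : ℕ × ℕ) :
    MeasurableSet {z : (Fin n → 𝔼 d) × (ℕ × ℕ → (𝔼 d) × ℝ) |
      Accepts (kde K σ z.1) (Γ z.1) lam (z.2 p)} := by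
  have hp : Measurable fun z : (Fin n → 𝔼 d) × (ℕ × ℕ → (𝔼 d) × ℝ) => z.2 p :=
    (measurable_pi_apply p).comp measurable_snd
  have hk : Measurable fun z : (Fin n → 𝔼 d) × (ℕ × ℕ → (𝔼 d) × ℝ) => kde K σ z.1 (z.2 p).1 :=
    measurable_kde hK hσ measurable_fst (measurable_fst.comp hp)
  exact (measurableSet_le ((hΓ.comp measurable_fst).mul (measurable_snd.comp hp)) hk).inter
    (measurableSet_le measurable_const hk)

/-- On data in `G`, for which the thresholded estimate has mass at least `q` in `A`, all loops
stop, and it is unlikely that none of `B` loops returns a point of `A`. -/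
lemma rejection_sampling_bounds (hK : IsKernelProfile d K) (hσ : 0 < σ) (hn : 0 < n)
    (hlam : 0 < lam)
    (hV : MeasurableSet V) (hV_fin : volume V ≠ ⊤) (hV0 : volume V ≠ 0) (hΓ : Measurable Γ)
    (hD : Measurable D) (hW : ∀ p, Measurable (W p)) (hW_indep : iIndepFun W μ)
    (hW_law : ∀ p, μ.map (W p) =
      (ProbabilityTheory.cond volume V).prod (volume.restrict (Set.Ioo (0 : ℝ) 1)))
    (hDW : IndepFun D (fun ω p => W p ω) μ)
    {G : Set (Fin n → 𝔼 d)} (hG : MeasurableSet G) (hGΓ : ∀ v ∈ G, ∀ x ∈ V, kde K σ v x ≤ Γ v)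
    {A : Set (𝔼 d)} (hA : MeasurableSet A) (hAV : A ⊆ V) {q : ℝ} (hq0 : 0 < q)
    (hq : ∀ v ∈ G, q ≤ ∫ x in A ∩ {x | lam ≤ kde K σ v x}, kde K σ v x) (B : ℕ) :
    μ.real {ω | D ω ∈ G ∧ ∀ k < B, ¬ ∃ x ∈ A,
        LoopReturns (kde K σ (D ω)) (Γ (D ω)) lam (fun j => W (k, j) ω) x} ≤
      Real.exp (-(q * B)) ∧
    μ {ω | D ω ∈ G ∧ ∃ k, ¬ ∃ x,
        LoopReturns (kde K σ (D ω)) (Γ (D ω)) lam (fun j => W (k, j) ω) x} = 0 := by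
  have hcondp : IsProbabilityMeasure (ProbabilityTheory.cond volume V) :=
    cond_isProbabilityMeasure_of_finite hV0 hV_fin
  have hIoo : IsProbabilityMeasure (volume.restrict (Set.Ioo (0 : ℝ) 1)) := ⟨by simp⟩
  have hWm : Measurable fun ω p => W p ω := measurable_pi_iff.2 hW
  have hkm : ∀ v : Fin n → 𝔼 d, Measurable (kde K σ v) := fun v =>
    measurable_kde hK hσ measurable_const measurable_id
  have hodds := fun v (hv : v ∈ G) => accepts_odds hV hV_fin (hkm v) (kde_nonneg hK hσ v)
    (integrable_kde hK hσ v) (integral_kde hK hσ hn v).le hlam (hGΓ v hv) hA hAV hq0 (hq v hv)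
  have hacc := measurableSet_accepts_kde (n := n) (lam := lam) hK hσ hΓ
  constructor
  · set E : Set ((Fin n → 𝔼 d) × (ℕ × ℕ → (𝔼 d) × ℝ)) := {z | z.1 ∈ G ∧ ∀ k < B, ¬ ∃ j,
      Accepts (kde K σ z.1) (Γ z.1) lam (z.2 (k, j)) ∧
      (∀ i < j, ¬ Accepts (kde K σ z.1) (Γ z.1) lam (z.2 (k, i))) ∧
      (z.2 (k, j)).1 ∈ A} with hE
    have hEm : MeasurableSet E := by
      refine (measurable_fst hG).inter ?_
      have : {z : (Fin n → 𝔼 d) × (ℕ × ℕ → (𝔼 d) × ℝ) | ∀ k < B, ¬ ∃ j,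
          Accepts (kde K σ z.1) (Γ z.1) lam (z.2 (k, j)) ∧
          (∀ i < j, ¬ Accepts (kde K σ z.1) (Γ z.1) lam (z.2 (k, i))) ∧
          (z.2 (k, j)).1 ∈ A} = ⋂ k ∈ Finset.range B, (⋃ j,
          {z | Accepts (kde K σ z.1) (Γ z.1) lam (z.2 (k, j))} ∩
          ((⋂ i ∈ Finset.range j, {z | Accepts (kde K σ z.1) (Γ z.1) lam (z.2 (k, i))}ᶜ) ∩
          (fun z => (z.2 (k, j)).1) ⁻¹' A))ᶜ := by
        ext z
        simp
      change MeasurableSet {z : (Fin n → 𝔼 d) × (ℕ × ℕ → (𝔼 d) × ℝ) | ∀ k < B, _}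
      rw [this]
      refine Finset.measurableSet_biInter _ fun k _ => (MeasurableSet.iUnion fun j => ?_).compl
      refine (hacc _).inter ((Finset.measurableSet_biInter _ fun i _ => (hacc _).compl).inter ?_)
      exact (measurable_fst.comp ((measurable_pi_apply (k, j)).comp measurable_snd)) hA
    have hsub : {ω | D ω ∈ G ∧ ∀ k < B, ¬ ∃ x ∈ A,
        LoopReturns (kde K σ (D ω)) (Γ (D ω)) lam (fun j => W (k, j) ω) x} ⊆
        {ω | (D ω, fun p => W p ω) ∈ E} := by
      rintro ω ⟨h1, h2⟩
      refine ⟨h1, fun k hk => ?_⟩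
      rintro ⟨j, hj1, hj2, hj3⟩
      exact h2 k hk ⟨_, hj3, j, hj1, hj2, rfl⟩
    refine (measureReal_mono hsub).trans
      (ENNReal.toReal_le_of_le_ofReal (Real.exp_pos _).le ?_)
    -- Freezing the data at `v` leaves a fixed acceptance region, to which the bound for i.i.d.
    -- draws applies; for `v ∉ G` the slice is empty.
    refine measure_pair_mem_le hD hWm hDW hEm fun v => ?_
    by_cases hv : v ∈ G
    · have := measureReal_forall_not_first_mem_le hW hW_indep hW_law
        (measurableSet_accepts (Γ := Γ v) (lam := lam) (hkm v)) (measurable_fst hA)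
        (hodds v hv).1 (hodds v hv).2 B
      refine (ENNReal.le_ofReal_iff_toReal_le (measure_ne_top _ _) (Real.exp_pos _).le).2
        (le_trans (measureReal_mono ?_) this)
      exact fun ω hω => hω.2
    · have : {ω | (v, fun p => W p ω) ∈ E} = ∅ := by
        ext ω
        simp [hE, hv]
      rw [this]
      simp
  · set E : Set ((Fin n → 𝔼 d) × (ℕ × ℕ → (𝔼 d) × ℝ)) := {z | z.1 ∈ G ∧ ∃ k, ∀ j,
      ¬ Accepts (kde K σ z.1) (Γ z.1) lam (z.2 (k, j))} with hE
    have hEm : MeasurableSet E := by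
      refine (measurable_fst hG).inter ?_
      have : {z : (Fin n → 𝔼 d) × (ℕ × ℕ → (𝔼 d) × ℝ) | ∃ k, ∀ j,
          ¬ Accepts (kde K σ z.1) (Γ z.1) lam (z.2 (k, j))} = ⋃ k, ⋂ j,
          {z | Accepts (kde K σ z.1) (Γ z.1) lam (z.2 (k, j))}ᶜ := by
        ext z
        simp
      change MeasurableSet {z : (Fin n → 𝔼 d) × (ℕ × ℕ → (𝔼 d) × ℝ) | ∃ k, _}
      rw [this]
      exact .iUnion fun k => .iInter fun j => (hacc _).compl
    have hsub : {ω | D ω ∈ G ∧ ∃ k, ¬ ∃ x,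
        LoopReturns (kde K σ (D ω)) (Γ (D ω)) lam (fun j => W (k, j) ω) x} ⊆
        {ω | (D ω, fun p => W p ω) ∈ E} := by
      rintro ω ⟨h1, k, hk⟩
      refine ⟨h1, k, fun j hj => hk (exists_loopReturns ⟨j, hj⟩)⟩
    refine le_antisymm ((measure_mono hsub).trans ?_) zero_le
    refine measure_pair_mem_le hD hWm hDW hEm fun v => ?_
    by_cases hv : v ∈ G
    · have : {ω | (v, fun p => W p ω) ∈ E} ⊆
          ⋃ k, {ω | ∀ j, W (k, j) ω ∉ {p | Accepts (kde K σ v) (Γ v) lam p}} := by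
        rintro ω ⟨_, k, hk⟩
        exact Set.mem_iUnion.2 ⟨k, hk⟩
      refine (measure_mono this).trans (le_of_eq (measure_iUnion_null fun k => ?_))
      refine measure_forall_notMem_eq_zero (fun j => hW (k, j))
        (hW_indep.precomp (Prod.mk_right_injective k)) (fun j => hW_law (k, j))
        (measurableSet_accepts (hkm v)) ?_
      exact (ENNReal.toReal_pos_iff.1 (hodds v hv).1).1.ne'
    · have : {ω | (v, fun p => W p ω) ∈ E} = ∅ := by
        ext ω
        simp [hE, hv]
      rw [this]
      simp

end Subsample

/-! ### The scale of the fluctuations -/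

/-- The larger of the bandwidth and the radius of balls that hold about `log n` data points. -/
def scale (d : ℕ) (σ : ℕ → ℝ) (n : ℕ) : ℝ := max (σ n) ((Real.log n / n) ^ (1 / (d : ℝ)))

/-- All exponents in the probability bounds are multiples of `n * s ^ d`; this compares them with
`log n`. -/
lemma log_le_mul_scale_pow (hd : 0 < d) (σ : ℕ → ℝ) {n : ℕ} (hn : 0 < n) :
    Real.log n ≤ n * scale d σ n ^ d := by
  have hn0 : (0 : ℝ) < n := by exact_mod_cast hn
  have h0 : 0 ≤ Real.log n / n := div_nonneg (Real.log_natCast_nonneg n) hn0.le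
  rw [← div_le_iff₀' hn0]
  calc Real.log n / n = ((Real.log n / n) ^ (1 / (d : ℝ))) ^ d := by
        rw [← Real.rpow_natCast, ← Real.rpow_mul h0, one_div, inv_mul_cancel₀ (by positivity),
          Real.rpow_one]
    _ ≤ scale d σ n ^ d := pow_le_pow_left₀ (Real.rpow_nonneg h0 _) (le_max_right _ _) d

lemma tendsto_scale (hd : 0 < d) {σ : ℕ → ℝ} (hσ : Tendsto σ atTop (𝓝 0)) :
    Tendsto (scale d σ) atTop (𝓝 0) := by
  have h1 : Tendsto (fun n : ℕ => Real.log n / n) atTop (𝓝 0) :=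
    Real.isLittleO_log_id_atTop.tendsto_div_nhds_zero.comp tendsto_natCast_atTop_atTop
  have hd' : 0 < 1 / (d : ℝ) := by positivity
  have h2 := h1.rpow_const (p := 1 / (d : ℝ)) (Or.inr hd'.le)
  rw [Real.zero_rpow hd'.ne'] at h2
  have h3 := hσ.max h2
  rwa [max_self] at h3

lemma tendsto_mul_scale {σ β : ℕ → ℝ} (hβ_nonneg : ∀ n, 0 ≤ β n)
    (hβ : β =o[atTop] fun n : ℕ => ((n : ℝ) / Real.log n) ^ (1 / (d : ℝ)))
    (hβσ : Tendsto (fun n => β n * σ n) atTop (𝓝 0)) :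
    Tendsto (fun n => β n * scale d σ n) atTop (𝓝 0) := by
  have h1 : Tendsto (fun n : ℕ => β n * (Real.log n / n) ^ (1 / (d : ℝ))) atTop (𝓝 0) := by
    refine hβ.tendsto_div_nhds_zero.congr fun n => ?_
    rw [div_eq_mul_inv, ← Real.inv_rpow (div_nonneg (Nat.cast_nonneg n)
      (Real.log_natCast_nonneg n)), inv_div]
  have h2 := hβσ.max h1
  rw [max_self] at h2
  exact h2.congr fun n => (mul_max_of_nonneg _ _ (hβ_nonneg n)).symm

/-- Reduces the second alternative on the rate to the first: `β * σ ≤ σ + β ^ (d + 1) * σ`, where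
the first term serves for `β ≤ 1` and the second for `β ≥ 1`. -/
lemma tendsto_mul_of_tendsto_pow_mul {β σ : ℕ → ℝ} (hβ : ∀ n, 0 ≤ β n) (hσ_pos : ∀ n, 0 < σ n)
    (hσ : Tendsto σ atTop (𝓝 0)) (h : Tendsto (fun n => β n ^ (d + 1) * σ n) atTop (𝓝 0)) :
    Tendsto (fun n => β n * σ n) atTop (𝓝 0) := by
  have hadd := hσ.add h
  rw [add_zero] at hadd
  refine squeeze_zero (fun n => mul_nonneg (hβ n) (hσ_pos n).le) (fun n => ?_) hadd
  have hs := (hσ_pos n).le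
  rcases le_total (β n) 1 with hb | hb
  · have := mul_le_of_le_one_left hs hb
    have : 0 ≤ β n ^ (d + 1) * σ n := mul_nonneg (pow_nonneg (hβ n) _) hs
    linarith
  · have : β n * σ n ≤ β n ^ (d + 1) * σ n :=
      mul_le_mul_of_nonneg_right (le_self_pow₀ hb (Nat.succ_ne_zero d)) hs
    linarith

lemma IsKernelProfile.tendsto_setIntegral_ball (hK : IsKernelProfile d K) :
    Tendsto (fun r : ℝ => ∫ u in Metric.ball (0 : 𝔼 d) r, K ‖u‖) atTop (𝓝 1) := by
  have h := tendsto_setIntegral_of_monotone (μ := (volume : Measure (𝔼 d)))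
    (f := fun u : 𝔼 d => K ‖u‖) (s := fun r : ℝ => Metric.ball (0 : 𝔼 d) r)
    (fun r => Metric.isOpen_ball.measurableSet)
    (fun _ _ hab => Metric.ball_subset_ball hab) hK.integrable.integrableOn
  have hU : ⋃ r : ℝ, Metric.ball (0 : 𝔼 d) r = Set.univ := by
    refine Set.eq_univ_of_forall fun x => Set.mem_iUnion.2 ⟨‖x‖ + 1, ?_⟩
    simp
  rwa [hU, setIntegral_univ, hK.integral_eq_one] at h

lemma IsKernelProfile.tendsto_setIntegral_compl_ball (hK : IsKernelProfile d K) :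
    Tendsto (fun r : ℝ => ∫ u in (Metric.ball (0 : 𝔼 d) r)ᶜ, K ‖u‖) atTop (𝓝 0) := by
  have h := hK.tendsto_setIntegral_ball.const_sub 1
  rw [sub_self] at h
  refine h.congr fun r => ?_
  rw [setIntegral_compl Metric.isOpen_ball.measurableSet hK.integrable, hK.integral_eq_one]

/-! ### Deterministic consequences of the concentration -/

/-- The discarded part of `A`, where `g < lam`, has mass at most `lam` times the volume of `A`. -/
lemma sub_le_setIntegral_superlevel {g : (𝔼 d) → ℝ} (hg : Measurable g) (h_int : Integrable g)
    (lam : ℝ) {A : Set (𝔼 d)} (hA : MeasurableSet A) (hA_fin : volume A ≠ ⊤) (hlam : 0 ≤ lam) :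
    (∫ x in A, g x) - lam * volume.real A ≤ ∫ x in A ∩ {x | lam ≤ g x}, g x := by
  have hL : MeasurableSet {x | lam ≤ g x} := measurableSet_le measurable_const hg
  rw [← integral_inter_add_sdiff (s := A) hL h_int.integrableOn]
  have h1 : ∫ x in A \ {x | lam ≤ g x}, g x ≤ lam * volume.real A := by
    have hfin : volume (A \ {x | lam ≤ g x}) ≠ ⊤ := measure_ne_top_of_subset Set.sdiff_subset hA_fin
    calc ∫ x in A \ {x | lam ≤ g x}, g x ≤ ∫ _ in A \ {x | lam ≤ g x}, lam :=
          setIntegral_mono_on h_int.integrableOn (integrableOn_const hfin) (hA.diff hL)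
            fun x hx => (not_le.1 hx.2).le
      _ = lam * volume.real (A \ {x | lam ≤ g x}) := by
          rw [setIntegral_const, smul_eq_mul, mul_comm]
      _ ≤ lam * volume.real A :=
          mul_le_mul_of_nonneg_left (measureReal_mono Set.sdiff_subset hA_fin) hlam
  linarith

/-- If `B(y, (1 - η) R)` holds its share of the data, the estimate thresholded at `lam` has mass
of the order of the volume in `B(y, R)`. -/
lemma mass_le_setIntegral_superlevel_kde (hK : IsKernelProfile d K) (hσ : 0 < σ) (hn : 0 < n)
    {lam l η R ρ : ℝ} (hlam : 0 ≤ lam) (hη0 : 0 ≤ η) (hη1 : η ≤ 1) (hR : 0 < R)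
    (hρ : ρ * σ ≤ R)
    (hKρ : 1 - η ≤ ∫ u in Metric.ball (0 : 𝔼 d) (η * ρ), K ‖u‖)
    (v : Fin n → 𝔼 d) (y : 𝔼 d)
    (hv : (1 - η) * (n * (l * (((1 - η) * R) ^ d * volume.real (Metric.ball (0 : 𝔼 d) 1)))) ≤
      hits (Metric.ball y ((1 - η) * R)) v) :
    ((1 - η) ^ (d + 2) * l - lam) * (R ^ d * volume.real (Metric.ball (0 : 𝔼 d) 1)) ≤
      ∫ x in Metric.ball y R ∩ {x | lam ≤ kde K σ v x}, kde K σ v x := by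
  have hη' : 0 ≤ 1 - η := by linarith
  have hn0 : (0 : ℝ) < n := by exact_mod_cast hn
  have hkm : Measurable (kde K σ v) := measurable_kde hK hσ measurable_const measurable_id
  refine le_trans ?_ (sub_le_setIntegral_superlevel hkm (integrable_kde hK hσ v) lam
    Metric.isOpen_ball.measurableSet Metric.isBounded_ball.measure_lt_top.ne hlam)
  rw [volume_real_ball y hR]
  have h1 := hits_mul_le_setIntegral_kde hK hσ v y R η
  have h2 : 1 - η ≤ ∫ u in Metric.ball (0 : 𝔼 d) (η * R / σ), K ‖u‖ := by
    refine hKρ.trans (setIntegral_mono_set hK.integrable.integrableOn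
      (ae_of_all _ fun u => hK.nonneg _ (norm_nonneg _)) (ae_of_all _ ?_))
    refine Metric.ball_subset_ball ?_
    rw [mul_div_assoc]
    exact mul_le_mul_of_nonneg_left ((le_div_iff₀ hσ).2 hρ) hη0
  -- Of the `d + 2` factors `1 - η`, `d` come from the smaller radius, one from the hit count and
  -- one from the kernel mass.
  have h3 : (1 - η) ^ (d + 2) * l * (R ^ d * volume.real (Metric.ball (0 : 𝔼 d) 1)) ≤
      1 / n * (hits (Metric.ball y ((1 - η) * R)) v *
        ∫ u in Metric.ball (0 : 𝔼 d) (η * R / σ), K ‖u‖) := by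
    calc (1 - η) ^ (d + 2) * l * (R ^ d * volume.real (Metric.ball (0 : 𝔼 d) 1))
        = 1 / n * ((1 - η) *
          (n * (l * (((1 - η) * R) ^ d * volume.real (Metric.ball (0 : 𝔼 d) 1)))) * (1 - η)) := by
          rw [mul_pow, pow_add]
          field_simp
      _ ≤ _ := by
          refine mul_le_mul_of_nonneg_left ?_ (by positivity)
          exact mul_le_mul hv h2 hη' (hits_nonneg _ _)
  linarith

/-- Bounds on the numbers of hits in balls centred in a net extend to all balls. -/
lemma hits_ball_le_of_net {S : Type*} [PseudoMetricSpace S] {A : Set S} {N : Finset S} {s m : ℝ}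
    (hN : ∀ x ∈ A, ∃ y ∈ N, dist x y < s) (hm : 0 ≤ m) {v : Fin n → S} (hv : ∀ i, v i ∈ A)
    (h : ∀ y ∈ N, hits (Metric.ball y (3 * s)) v ≤ m) (z : S) :
    hits (Metric.ball z s) v ≤ m := by
  by_cases hz : ∃ i, v i ∈ Metric.ball z s
  · obtain ⟨i, hi⟩ := hz
    obtain ⟨y, hyN, hy⟩ := hN (v i) (hv i)
    refine (hits_mono (fun x hx => ?_) v).trans (h y hyN)
    -- `3 * s`: from `x` to `z`, from `z` to the data point `v i`, from there to the net.
    rw [Metric.mem_ball] at hx hi ⊢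
    rw [dist_comm] at hi
    linarith [dist_triangle x z y, dist_triangle z (v i) y]
  · push Not at hz
    have : hits (Metric.ball z s) v = 0 :=
      Finset.sum_eq_zero fun i _ => Set.indicator_of_notMem (hz i) _
    rwa [this]

/-- Far from the data the estimate is below the threshold. -/
lemma exists_dist_le_of_le_kde (hK : IsKernelProfile d K) (hσ : 0 < σ) (hn : 0 < n) {s : ℝ}
    (hs : σ ≤ s) {C T lam : ℝ} (hT : 2 ≤ T)
    (htail : C * (2 ^ d * ∫ u in (Metric.ball (0 : 𝔼 d) (T / 4))ᶜ, K ‖u‖) <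
      lam * volume.real (Metric.ball (0 : 𝔼 d) 1))
    {v : Fin n → 𝔼 d} (hv : ∀ z, hits (Metric.ball z s) v ≤ C * (n * s ^ d))
    {x : 𝔼 d} (hx : lam ≤ kde K σ v x) : ∃ i, dist x (v i) ≤ T * s := by
  by_contra! hcon
  have hs0 := hσ.trans_le hs
  have hn0 : (0 : ℝ) < n := by exact_mod_cast hn
  have h := kde_le_tail hK hσ hs hT v hv x fun i => (hcon i).le
  rw [volume_real_ball _ hs0] at h
  have hsd : 0 < s ^ d := by positivity
  have h1 : s ^ d * (lam * volume.real (Metric.ball (0 : 𝔼 d) 1)) ≤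
      s ^ d * volume.real (Metric.ball (0 : 𝔼 d) 1) * kde K σ v x := by
    rw [mul_assoc, mul_comm lam]
    gcongr
  -- The factor `s ^ d` is common to both sides, so the condition on `T` does not depend on `n`.
  have h2 : 1 / (n : ℝ) * (C * (n * s ^ d) *
      (2 ^ d * ∫ u in (Metric.ball (0 : 𝔼 d) (T / 4))ᶜ, K ‖u‖)) =
      s ^ d * (C * (2 ^ d * ∫ u in (Metric.ball (0 : 𝔼 d) (T / 4))ᶜ, K ‖u‖)) := by
    field_simp
  rw [h2] at h
  exact absurd (le_of_mul_le_mul_left (h1.trans h) hsd) (not_le.2 htail)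

/-- The gap between `lam` and the lower bound of the density pays for all losses `1 - η`. -/
lemma exists_margin (d : ℕ) {lam lam' : ℝ} (h : lam < lam') :
    ∃ η : ℝ, 0 < η ∧ η < 1 ∧ lam < (1 - η) ^ (d + 2) * lam' := by
  have hc : Tendsto (fun η : ℝ => (1 - η) ^ (d + 2) * lam') (𝓝[>] 0) (𝓝 lam') := by
    have : Continuous fun η : ℝ => (1 - η) ^ (d + 2) * lam' := by fun_prop
    have := this.tendsto 0
    simp only [sub_zero, one_pow, one_mul] at this
    exact this.mono_left nhdsWithin_le_nhds
  obtain ⟨η, h1, h2⟩ := ((hc.eventually_const_lt h).and (Ioo_mem_nhdsGT one_pos)).exists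
  exact ⟨η, h2.1, h2.2, h1⟩

/-- A thick set on which `P` has a density bounded below has nets of the optimal order. -/
lemma exists_net_of_density {P : Measure (𝔼 d)} [IsProbabilityMeasure P] {f : (𝔼 d) → ℝ}
    (hf_density : P = volume.withDensity (fun x => ENNReal.ofReal (f x)))
    {A : Set (𝔼 d)} {l c r₀ : ℝ} (hl : 0 < l) (hc : 0 < c) (hf : ∀ x ∈ A, l ≤ f x)
    (hthick : ∀ x ∈ A, ∀ r, 0 < r → r ≤ r₀ → ∃ y, Metric.ball y (c * r) ⊆ A ∩ Metric.ball x r)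
    {s : ℝ} (hs : 0 < s) (hsr : s / 2 ≤ r₀) :
    ∃ N : Finset (𝔼 d), ↑N ⊆ A ∧ (∀ x ∈ A, ∃ y ∈ N, dist x y < s) ∧
      N.card * s ^ d ≤ (l * ((c / 2) ^ d * volume.real (Metric.ball (0 : 𝔼 d) 1)))⁻¹ := by
  have hv := volume_real_unit_ball_pos (d := d)
  obtain ⟨N, h1, h2, h3⟩ := exists_finset_net P A (δ := s / 2)
    (a := l * ((c * (s / 2)) ^ d * volume.real (Metric.ball (0 : 𝔼 d) 1)))
    (by positivity) (by positivity) fun x hx => by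
      obtain ⟨y, hy⟩ := hthick x hx (s / 2) (by positivity) hsr
      refine (le_withDensity_real_ball hf_density hl.le (by positivity)
        fun z hz => hf z (hy hz).1).trans ?_
      exact measureReal_mono (hy.trans Set.inter_subset_right)
  refine ⟨N, h1, fun x hx => ?_, ?_⟩
  · simpa [mul_div_cancel₀] using h2 x hx
  · rw [← one_div, le_div_iff₀ (by positivity)]
    refine le_of_eq_of_le ?_ h3
    rw [mul_pow, div_pow, div_pow]
    ring

end

end SmoothSubsampling

/-! ### Choice of constants and proof of the main theorem -/

open SmoothSubsampling in
theorem mainTheorem1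
    {d : ℕ} (hd : 0 < d)
    -- the distribution `P`, its support, its density and the threshold
    (P : Measure (EuclideanSpace ℝ (Fin d))) [IsProbabilityMeasure P]
    (hcompact : IsCompact P.support) (hthick : IsThick P.support)
    (f : EuclideanSpace ℝ (Fin d) → ℝ) (hf_meas : Measurable f) (hf_nonneg : ∀ x, 0 ≤ f x)
    (hf_density : P = volume.withDensity (fun x => ENNReal.ofReal (f x)))
    (hf_bdd : ∃ M, ∀ x, f x ≤ M)
    (lam : ℝ) (hlam : 0 < lam)
    (hf_lower : ∃ lam' > lam, ∀ x ∈ P.support, lam' ≤ f x)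
    -- the kernel, the bandwidths and the rate
    (K : ℝ → ℝ) (hK : IsKernelProfile d K)
    (σ : ℕ → ℝ) (hσ_pos : ∀ n, 0 < σ n) (hσ : Tendsto σ atTop (𝓝 0))
    (β : ℕ → ℝ) (hβ_nonneg : ∀ n, 0 ≤ β n)
    (hβ : β =o[atTop] fun n : ℕ => ((n : ℝ) / Real.log n) ^ (1 / (d : ℝ)))
    (hβσ : Tendsto (fun n => β n * σ n) atTop (𝓝 0) ∨
      (K = gaussianProfile d ∧ Tendsto (fun n => β n ^ (d + 1) * σ n) atTop (𝓝 0)))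
    -- the i.i.d. data
    {Ω : Type*} [MeasurableSpace Ω] (μ : Measure Ω) [IsProbabilityMeasure μ]
    (X : ℕ → Ω → EuclideanSpace ℝ (Fin d)) (hX_meas : ∀ i, Measurable (X i))
    (hX_indep : iIndepFun X μ) (hX_law : ∀ i, μ.map (X i) = P)
    -- the input of the algorithm: enclosing region of the proposals, envelope constants,
    -- numbers of generated points
    (V : Set (EuclideanSpace ℝ (Fin d))) (hV_meas : MeasurableSet V)
    (hV_fin : volume V ≠ ⊤) (hV : P.support ⊆ V)
    (Γ : (n : ℕ) → (Fin n → EuclideanSpace ℝ (Fin d)) → ℝ) (hΓ_meas : ∀ n, Measurable (Γ n))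
    (hΓ : ∀ n (v : Fin n → EuclideanSpace ℝ (Fin d)), (∀ i, v i ∈ P.support) →
      ∀ x ∈ V, kde K (σ n) v x ≤ Γ n v)
    (B : ℕ → ℕ) (hB : (fun n : ℕ => (n : ℝ)) =O[atTop] fun n => (B n : ℝ))
    -- its random draws at sample size `n`: i.i.d. pairs (proposal uniform on `V`, uniform on
    -- `(0, 1)`), independent of the data
    (W : ℕ → ℕ × ℕ → Ω → EuclideanSpace ℝ (Fin d) × ℝ) (hW_meas : ∀ n p, Measurable (W n p))
    (hW_indep : ∀ n, iIndepFun (W n) μ)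
    (hW_law : ∀ n p, μ.map (W n p) =
      (ProbabilityTheory.cond volume V).prod (volume.restrict (Set.Ioo (0 : ℝ) 1)))
    (hXW : ∀ n, IndepFun (fun ω (i : Fin n) => X i ω) (fun ω p => W n p ω) μ) :
    ∀ᵐ ω ∂μ,
      -- all loops stop, for all large `n`
      (∀ᶠ n in atTop, ∀ k < B n, ∃ x,
        LoopReturns (kde K (σ n) fun i : Fin n => X i ω) (Γ n fun i => X i ω) lam
          (fun j => W n (k, j) ω) x) ∧
      Tendsto (fun n => β n * Metric.hausdorffDist
        (smoothSubsample (kde K (σ n) fun i : Fin n => X i ω) (Γ n fun i => X i ω) lam (B n)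
          fun p => W n p ω)
        P.support) atTop (𝓝 0) := by
  obtain ⟨c, hc, r₀, hr₀, hthick⟩ := hthick
  obtain ⟨M', hM'⟩ := hf_bdd
  obtain ⟨lam', hlam', hf_lower⟩ := hf_lower
  obtain ⟨η, hη0, hη1, hη⟩ := exists_margin d hlam'
  obtain ⟨b, hb, hBb⟩ := hB.exists_pos
  have hlam'0 : 0 < lam' := hlam.trans hlam'
  have hη' : 0 < 1 - η := by linarith
  set M : ℝ := max M' 0 with hM_def
  have hM0 : 0 ≤ M := le_max_right _ _
  have hM : ∀ x, f x ≤ M := fun x => (hM' x).trans (le_max_left _ _)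
  set u : ℝ := volume.real (Metric.ball (0 : EuclideanSpace ℝ (Fin d)) 1) with hu_def
  have hu : 0 < u := volume_real_unit_ball_pos
  set s : ℕ → ℝ := scale d σ with hs_def
  have hσs : ∀ n, σ n ≤ s n := fun n => le_max_left _ _
  have hs0 : ∀ n, 0 < s n := fun n => (hσ_pos n).trans_le (hσs n)
  have hs_lim : Tendsto s atTop (𝓝 0) := tendsto_scale hd hσ
  -- A ball of radius `3 * s` has expected count at most `M * (3 ^ d * u) * (n * s ^ d)`; with this
  -- `C` the upper Chernoff exponent is at most `-3 * n * s ^ d ≤ -3 * log n`.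
  set C : ℝ := 3 + 2 * (M * (3 ^ d * u)) with hC_def
  have hC : 0 < C := by positivity
  -- the radius, in units of the scale, at which the two sets are compared
  obtain ⟨T, hT2, hT_tail, hT_ball, hT_low, hT_ret⟩ : ∃ T : ℝ, 2 ≤ T ∧
      C * (2 ^ d * ∫ x in (Metric.ball (0 : EuclideanSpace ℝ (Fin d)) (T / 4))ᶜ, K ‖x‖) <
        lam * u ∧
      1 - η ≤ ∫ x in Metric.ball (0 : EuclideanSpace ℝ (Fin d)) (η * (c * T)), K ‖x‖ ∧
      3 ≤ η ^ 2 / 2 * (lam' * (((1 - η) * (c * T)) ^ d * u)) ∧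
      3 ≤ ((1 - η) ^ (d + 2) * lam' - lam) * ((c * T) ^ d * u) / b := by
    have hlin : ∀ a : ℝ, 0 < a → Tendsto (fun T : ℝ => a * T) atTop atTop := fun a ha =>
      tendsto_id.const_mul_atTop ha
    have hpow : ∀ a : ℝ, 0 < a → Tendsto (fun T : ℝ => (a * T) ^ d) atTop atTop := fun a ha =>
      (tendsto_pow_atTop hd.ne').comp (hlin a ha)
    have h1 : Tendsto (fun T : ℝ => C * (2 ^ d *
        ∫ x in (Metric.ball (0 : EuclideanSpace ℝ (Fin d)) (T / 4))ᶜ, K ‖x‖)) atTop (𝓝 0) := by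
      have := ((hK.tendsto_setIntegral_compl_ball.comp
        (tendsto_id.atTop_div_const (by norm_num : (0 : ℝ) < 4))).const_mul (2 ^ d)).const_mul C
      simpa only [mul_zero, Function.comp_def, id] using this
    have h2 : Tendsto (fun T : ℝ =>
        ∫ x in Metric.ball (0 : EuclideanSpace ℝ (Fin d)) (η * (c * T)), K ‖x‖) atTop (𝓝 1) :=
      hK.tendsto_setIntegral_ball.comp ((hlin c hc).const_mul_atTop hη0)
    have h3 : Tendsto (fun T : ℝ => η ^ 2 / 2 * (lam' * (((1 - η) * (c * T)) ^ d * u)))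
        atTop atTop := by
      simp only [← mul_assoc]
      have := ((hpow ((1 - η) * c) (by positivity)).const_mul_atTop
        (by positivity : 0 < η ^ 2 / 2 * lam')).atTop_mul_const hu
      simpa only [mul_assoc] using this
    have h4 : Tendsto (fun T : ℝ => ((1 - η) ^ (d + 2) * lam' - lam) * ((c * T) ^ d * u) / b)
        atTop atTop :=
      (((hpow c hc).atTop_mul_const hu).const_mul_atTop (sub_pos.2 hη)).atTop_div_const hb
    obtain ⟨T, hT⟩ := ((eventually_ge_atTop 2).and
      ((h1.eventually_lt_const (by positivity : 0 < lam * u)).and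
      ((h2.eventually_const_le (by linarith : 1 - η < 1)).and
      ((h3.eventually_ge_atTop 3).and (h4.eventually_ge_atTop 3))))).exists
    exact ⟨T, hT⟩
  have hT0 : 0 < T := by linarith
  set R : ℕ → ℝ := fun n => c * T * s n with hR_def
  have hR0 : ∀ n, 0 < R n := fun n => mul_pos (mul_pos hc hT0) (hs0 n)
  have hsmall : ∀ᶠ n in atTop, T * s n ≤ r₀ := by
    have := hs_lim.const_mul T
    rw [mul_zero] at this
    exact this.eventually_le_const hr₀
  -- the net of the support and the balls inside the support close to its points
  have hnet : ∀ n, ∃ N : Finset (EuclideanSpace ℝ (Fin d)), ↑N ⊆ P.support ∧ (T * s n ≤ r₀ →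
      (∀ x ∈ P.support, ∃ y ∈ N, dist x y < s n) ∧
      N.card * s n ^ d ≤ (lam' * ((c / 2) ^ d * u))⁻¹) := by
    intro n
    -- Thickness is available up to scale `r₀` only; the finitely many other `n` get a dummy net.
    by_cases h : T * s n ≤ r₀
    · obtain ⟨N, h1, h2⟩ := exists_net_of_density hf_density hlam'0 hc hf_lower hthick (hs0 n)
        (by nlinarith [hs0 n] : s n / 2 ≤ r₀)
      exact ⟨N, h1, fun _ => h2⟩
    · exact ⟨∅, by simp, fun h' => absurd h' h⟩
  choose N hN_sub hN using hnet
  choose! y hy using hthick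
  have hball : ∀ n, T * s n ≤ r₀ → ∀ j ∈ N n, Metric.ball (y j (T * s n)) (R n) ⊆
      P.support ∩ Metric.ball j (T * s n) := by
    intro n hn j hj
    have := hy j (hN_sub n hj) (T * s n) (mul_pos hT0 (hs0 n)) hn
    rwa [← mul_assoc] at this
  have hlog : ∀ n : ℕ, 0 < n → Real.log n ≤ n * s n ^ d := fun n hn => log_le_mul_scale_pow hd σ hn
  have hlog1 : ∀ᶠ n : ℕ in atTop, 1 ≤ Real.log n :=
    (Real.tendsto_log_atTop.comp tendsto_natCast_atTop_atTop).eventually_ge_atTop 1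
  -- `n * s ^ d ≥ log n ≥ 1` turns the net size `O(s ^ (-d))` into `O(n)`.
  have hcard : ∀ᶠ n : ℕ in atTop, ((N n).card : ℝ) ≤ (lam' * ((c / 2) ^ d * u))⁻¹ * n := by
    filter_upwards [hsmall, hlog1, eventually_gt_atTop 0] with n h1 h2 h3
    have h4 := ((hN n h1).2)
    have h5 := h2.trans (hlog n h3)
    calc ((N n).card : ℝ) ≤ (N n).card * (n * s n ^ d) := le_mul_of_one_le_right (by positivity) h5
      _ = (N n).card * s n ^ d * n := by ring
      _ ≤ _ := by gcongr
  -- no ball of the net holds too many data points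
  have hupper : ∀ᵐ ω ∂μ, ∀ᶠ n in atTop, ∀ j ∈ N n,
      ω ∉ {ω | C * (n * s n ^ d) ≤ hits (Metric.ball j (3 * s n)) fun i : Fin n => X i ω} := by
    refine ae_eventually_forall_notMem N _ _ hcard ?_
    filter_upwards [eventually_gt_atTop 0] with n hn j _
    refine (measureReal_le_hits_le hX_meas hX_indep hX_law
      Metric.isOpen_ball.measurableSet n _).trans (Real.exp_le_exp.2 ?_)
    have h1 := withDensity_real_ball_le hf_density hM0 hM j
      (mul_pos (by norm_num : (0 : ℝ) < 3) (hs0 n))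
    rw [mul_pow, ← hu_def] at h1
    have h2 := mul_le_mul_of_nonneg_left h1 (Nat.cast_nonneg (α := ℝ) n)
    have h3 := hlog n hn
    have h4 : (n : ℝ) * (M * (3 ^ d * s n ^ d * u)) = M * (3 ^ d * u) * (n * s n ^ d) := by ring
    rw [h4] at h2
    rw [hC_def]
    linarith
  have hmass : ∀ n, T * s n ≤ r₀ → ∀ j ∈ N n, lam' * (((1 - η) * R n) ^ d * u) ≤
      P.real (Metric.ball (y j (T * s n)) ((1 - η) * R n)) := by
    intro n hn j hj
    refine le_withDensity_real_ball hf_density hlam'0.le (mul_pos hη' (hR0 n)) fun x hx => ?_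
    refine hf_lower x (hball n hn j hj (Metric.ball_subset_ball ?_ hx)).1
    exact mul_le_of_le_one_left (hR0 n).le (by linarith)
  -- the balls inside the support hold their share of the data
  have hlower : ∀ᵐ ω ∂μ, ∀ᶠ n in atTop, ∀ j ∈ N n,
      ω ∉ {ω | hits (Metric.ball (y j (T * s n)) ((1 - η) * R n)) (fun i : Fin n => X i ω) ≤
        (1 - η) * (n * P.real (Metric.ball (y j (T * s n)) ((1 - η) * R n)))} := by
    refine ae_eventually_forall_notMem N _ _ hcard ?_
    filter_upwards [eventually_gt_atTop 0, hsmall] with n hn hn' j hj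
    refine (measureReal_hits_le_le hX_meas hX_indep hX_law
      Metric.isOpen_ball.measurableSet n hη0.le).trans (Real.exp_le_exp.2 (neg_le_neg ?_))
    calc 3 * Real.log n ≤ 3 * (n * s n ^ d) := by linarith [hlog n hn]
      _ ≤ η ^ 2 / 2 * (lam' * (((1 - η) * (c * T)) ^ d * u)) * (n * s n ^ d) :=
          mul_le_mul_of_nonneg_right hT_low
            (mul_nonneg (Nat.cast_nonneg n) (pow_nonneg (hs0 n).le d))
      _ = η ^ 2 / 2 * (n * (lam' * (((1 - η) * R n) ^ d * u))) := by
          simp only [hR_def, mul_pow]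
          ring
      _ ≤ _ := by
          gcongr
          exact hmass n hn' j hj
  -- good data
  set G : (n : ℕ) → Set (Fin n → EuclideanSpace ℝ (Fin d)) := fun n =>
    {v | (∀ i, v i ∈ P.support) ∧ ∀ j ∈ N n,
      (1 - η) * (n * (lam' * (((1 - η) * R n) ^ d * u))) ≤
        hits (Metric.ball (y j (T * s n)) ((1 - η) * R n)) v} with hG_def
  have hG_meas : ∀ n, MeasurableSet (G n) := by
    intro n
    have hG_eq : G n = (⋂ i : Fin n, (fun v => v i) ⁻¹' P.support) ∩ ⋂ j ∈ N n,
        {v | (1 - η) * (n * (lam' * (((1 - η) * R n) ^ d * u))) ≤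
          hits (Metric.ball (y j (T * s n)) ((1 - η) * R n)) v} := by
      ext v
      simp [hG_def]
    rw [hG_eq]
    exact (MeasurableSet.iInter fun i =>
      measurable_pi_apply i Measure.isClosed_support.measurableSet).inter
      (Finset.measurableSet_biInter _ fun j _ => measurableSet_le measurable_const
        (measurable_hits Metric.isOpen_ball.measurableSet))
  set q : ℕ → ℝ := fun n => ((1 - η) ^ (d + 2) * lam' - lam) * (R n ^ d * u) with hq_def
  have hq0 : ∀ n, 0 < q n := fun n =>
    mul_pos (sub_pos.2 hη) (mul_pos (pow_pos (hR0 n) d) hu)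
  have hbounds : ∀ n, 0 < n → T * s n ≤ r₀ → ∀ j ∈ N n,
      μ.real {ω | (fun i : Fin n => X i ω) ∈ G n ∧ ∀ k < B n,
        ¬ ∃ x ∈ Metric.ball (y j (T * s n)) (R n),
          LoopReturns (kde K (σ n) fun i : Fin n => X i ω) (Γ n fun i => X i ω) lam
            (fun j => W n (k, j) ω) x} ≤ Real.exp (-(q n * B n)) ∧
      μ {ω | (fun i : Fin n => X i ω) ∈ G n ∧ ∃ k, ¬ ∃ x,
          LoopReturns (kde K (σ n) fun i : Fin n => X i ω) (Γ n fun i => X i ω) lam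
            (fun j => W n (k, j) ω) x} = 0 := by
    intro n hn hn' j hj
    have hsub := hball n hn' j hj
    have hAV : Metric.ball (y j (T * s n)) (R n) ⊆ V := fun x hx => hV (hsub hx).1
    have hV0 : volume V ≠ 0 := fun h0 =>
      (Metric.measure_ball_pos volume (y j (T * s n)) (hR0 n)).ne' (measure_mono_null hAV h0)
    refine rejection_sampling_bounds hK (hσ_pos n) hn hlam hV_meas hV_fin hV0 (hΓ_meas n)
      (measurable_pi_iff.2 fun i => hX_meas i) (hW_meas n) (hW_indep n) (hW_law n) (hXW n)
      (hG_meas n) (fun v hv => hΓ n v hv.1) Metric.isOpen_ball.measurableSet hAV (hq0 n)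
      (fun v hv => ?_) (B n)
    refine mass_le_setIntegral_superlevel_kde (ρ := c * T) hK (hσ_pos n) hn hlam.le hη0.le hη1.le
      (hR0 n) ?_ hT_ball v _ (hv.2 j hj)
    exact mul_le_mul_of_nonneg_left (hσs n) (by positivity)
  have hreturn : ∀ᵐ ω ∂μ, ∀ᶠ n in atTop, ∀ j ∈ N n,
      ω ∉ {ω | (fun i : Fin n => X i ω) ∈ G n ∧ ∀ k < B n,
        ¬ ∃ x ∈ Metric.ball (y j (T * s n)) (R n),
          LoopReturns (kde K (σ n) fun i : Fin n => X i ω) (Γ n fun i => X i ω) lam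
            (fun j => W n (k, j) ω) x} := by
    refine ae_eventually_forall_notMem N _ _ hcard ?_
    filter_upwards [eventually_gt_atTop 0, hsmall, hBb.bound] with n hn hn' hB' j hj
    refine (hbounds n hn hn' j hj).1.trans (Real.exp_le_exp.2 (neg_le_neg ?_))
    rw [Real.norm_natCast, Real.norm_natCast] at hB'
    calc 3 * Real.log n ≤ 3 * (n * s n ^ d) := by linarith [hlog n hn]
      _ ≤ ((1 - η) ^ (d + 2) * lam' - lam) * ((c * T) ^ d * u) / b * (n * s n ^ d) :=
          mul_le_mul_of_nonneg_right hT_ret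
            (mul_nonneg (Nat.cast_nonneg n) (pow_nonneg (hs0 n).le d))
      _ = q n * (n / b) := by
          simp only [hq_def, hR_def, mul_pow]
          ring
      _ ≤ q n * B n := mul_le_mul_of_nonneg_left ((div_le_iff₀' hb).2 hB') (hq0 n).le
  have hsupp_ne : P.support.Nonempty := Measure.nonempty_support (NeZero.ne P)
  have h_all_return : ∀ᵐ ω ∂μ, ∀ n, 0 < n → T * s n ≤ r₀ →
      ω ∉ {ω | (fun i : Fin n => X i ω) ∈ G n ∧ ∃ k, ¬ ∃ x,
          LoopReturns (kde K (σ n) fun i : Fin n => X i ω) (Γ n fun i => X i ω) lam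
            (fun j => W n (k, j) ω) x} := by
    refine ae_all_iff.2 fun n => ?_
    by_cases hn : 0 < n ∧ T * s n ≤ r₀
    · obtain ⟨x, hx⟩ := hsupp_ne
      -- Any net point will do: a positive acceptance probability near it makes all loops stop.
      obtain ⟨j, hj, -⟩ := (hN n hn.2).1 x hx
      filter_upwards [measure_eq_zero_iff_ae_notMem.1 (hbounds n hn.1 hn.2 j hj).2] with ω hω _ _
      exact hω
    · exact ae_of_all _ fun ω h1 h2 => absurd ⟨h1, h2⟩ hn
  have hdata : ∀ᵐ ω ∂μ, ∀ i, X i ω ∈ P.support := by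
    refine ae_all_iff.2 fun i => ae_of_ae_map (hX_meas i).aemeasurable ?_
    rw [hX_law i]
    exact Measure.support_mem_ae
  have hrate : Tendsto (fun n => β n * s n) atTop (𝓝 0) := by
    refine tendsto_mul_scale hβ_nonneg hβ ?_
    rcases hβσ with h | ⟨-, h⟩
    · exact h
    · exact tendsto_mul_of_tendsto_pow_mul hβ_nonneg hσ_pos hσ h
  filter_upwards [hupper, hlower, hreturn, h_all_return, hdata]
    with ω h_up h_low h_ret h_loops h_data
  have hgood : ∀ᶠ n in atTop, 0 < n ∧ T * s n ≤ r₀ ∧ (fun i : Fin n => X i ω) ∈ G n := by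
    filter_upwards [eventually_gt_atTop 0, hsmall, h_low] with n hn hn' hl
    refine ⟨hn, hn', fun i => h_data i, fun j hj => ?_⟩
    refine le_trans ?_ (not_le.1 (hl j hj)).le
    gcongr
    exact hmass n hn' j hj
  constructor
  · filter_upwards [hgood] with n ⟨hn, hn', hG⟩ k _
    by_contra hcon
    exact h_loops n hn hn' ⟨hG, k, hcon⟩
  · have hlim : Tendsto (fun n => (T + 1) * (β n * s n)) atTop (𝓝 0) := by
      simpa using hrate.const_mul (T + 1)
    refine squeeze_zero' (Eventually.of_forall fun n =>
      mul_nonneg (hβ_nonneg n) Metric.hausdorffDist_nonneg) ?_ hlim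
    filter_upwards [hgood, h_up, h_ret] with n ⟨hn, hn', hG⟩ hu' hr
    rw [mul_left_comm]
    refine mul_le_mul_of_nonneg_left ?_ (hβ_nonneg n)
    -- `T * s` bounds the distance to the data or from a net point to a returned point, and `s` the
    -- distance to the net. The value `0` that `Metric.hausdorffDist` takes at an empty set plays no
    -- role: the support is nonempty, so the second bound yields a returned point.
    refine Metric.hausdorffDist_le_of_mem_dist (mul_nonneg (by linarith) (hs0 n).le) ?_ ?_
    · rintro x ⟨k, -, j, hacc, -, rfl⟩
      have hhits := hits_ball_le_of_net (hN n hn').1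
        (m := C * (n * s n ^ d)) (by have := hs0 n; positivity) hG.1
        fun j hj => (not_le.1 (hu' j hj)).le
      obtain ⟨i, hi⟩ := exists_dist_le_of_le_kde hK (hσ_pos n) hn (hσs n) hT2 hT_tail hhits hacc.2
      exact ⟨_, hG.1 i, hi.trans (by nlinarith [hs0 n])⟩
    · intro x hx
      obtain ⟨j, hj, hxj⟩ := (hN n hn').1 x hx
      have hex : ∃ k < B n, ∃ x ∈ Metric.ball (y j (T * s n)) (R n),
          LoopReturns (kde K (σ n) fun i : Fin n => X i ω) (Γ n fun i => X i ω) lam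
            (fun j => W n (k, j) ω) x := by
        by_contra! hcon
        exact hr j hj ⟨hG, fun k hk ⟨x, hx, hx'⟩ => hcon k hk x hx hx'⟩
      obtain ⟨k, hk, z, hz, hret⟩ := hex
      refine ⟨z, ⟨k, hk, hret⟩, ?_⟩
      have h1 := (hball n hn' j hj hz).2
      rw [Metric.mem_ball, dist_comm] at h1
      linarith [dist_triangle x j z]
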